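/- Let $d\ge 2$, $T\in\mathbb N$, $\lambda\ge 1$, $\delta\in(0,1)$, $\rho\ge 0$. Let $\mathcal X\subseteq\mathbb R^d$ be closed, star-convex with respect to the origin, with $\|u\|_2\le 1$ for all $u\in\mathcal X$, and let $\theta\in\mathbb R^d$ with $\|\theta\|_2\le S_\theta$, $S_\theta>0$. At round $t\in\{1,\dots,T\}$ a random action $x_t\in\mathbb R^d$ is played and $y_t=\theta^\top x_t+\epsilon_t$ is observed. Call a scalar noise process $(\xi_t)$ *conditionally $\rho$-subgaussian* if for all $t\in\{1,\dots,T\}$, with $\mathcal F_t=\sigma(x_1,\dots,x_t,\xi_1,\dots,\xi_{t-1})$, one has $\mathbb E[\xi_t\mid\mathcal F_t]=0$ and $\mathbb E[e^{s\xi_t}\mid\mathcal F_t]\le e^{s^2\rho^2/2}$ almost surely for every $s\in\mathbb R$. Assume that $(\epsilon_t)$ is conditionally $\rho$-subgaussian. Write $$V_t=\lambda I+\sum_{k=1}^{t-1}x_kx_k^\top,\qquad \hat\theta_t=V_t^{-1}\sum_{k=1}^{t-1}x_ky_k,\qquad \|u\|_{V_t^{-1}}=\sqrt{u^\top V_t^{-1}u}.$$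 **(1) Linked convex constraints.** Let $n\ge1$, let $A\in\mathbb R^{n\times d}$ have rows $a_i$ with $\|a_i\|_2\le S_A$, $S_A>0$, and let $\mathcal G\subseteq\mathbb R^n$ be convex and contain the closed Euclidean ball of radius $r>0$ about $0$, with $r/(\sqrt n\,S_A)\le1$. At each round $z_t=Ax_t+\eta_t\in\mathbb R^n$ is observed, where each coordinate process $(\eta_{t,i})_t$ is conditionally $\rho$-subgaussian. Put $S=\max(S_A,S_\theta)$, $$\beta_t=\rho\sqrt{d\log\frac{1+(t-1)/\lambda}{\delta/(n+1)}}+\sqrt\lambda\,S,$$ let $\hat A_t$ be the matrix whose $i$-th row is $V_t^{-1}\sum_{k=1}^{t-1}x_kz_{k,i}$, let $\mathbb B_\infty$ be the closed unit ball of the sup norm of $\mathbb R^n$, and let $\mathcal Y_t^p=\{u\in\mathcal X:\hat A_tu+\beta_t\|u\|_{V_t^{-1}}\mathbb B_\infty\subseteq\mathcal G\}$. Let $x_*$ maximize $u\mapsto\theta^\top u$ over $\mathcal Y=\{u\in\mathcal X:Au\in\mathcal G\}$, with $\theta^\top x_*>0$. Suppose that the actions follow OPLB with $\kappa=1+2\sqrt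 n\,S_\theta/r$, that is, for all $t\in\{1,\dots,T\}$, $$x_t\in\operatorname*{argmax}_{u\in\mathcal Y_t^p}\bigl(\hat\theta_t^\top u+\kappa\beta_t\|u\|_{V_t^{-1}}\bigr).$$ Then, with probability at least $1-\delta$, $$R_T:=\sum_{t=1}^T\theta^\top(x_*-x_t)\le 2\Bigl(1+\frac{\sqrt n\,S_\theta}{r}\Bigr)\beta_T\sqrt{2dT\log\Bigl(1+\frac{T}{\lambda d}\Bigr)}.$$ **(2) A single linear constraint.** Let instead $a\in\mathbb R^d$ with $\|a\|_2\le S_a$, $S_a>0$, and $b>0$ with $b/S_a\le 1$. At each round $z_t=a^\top x_t+\eta_t\in\mathbb R$ is observed, where $(\eta_t)$ is conditionally $\rho$-subgaussian. Put $S=\max(S_a,S_\theta)$, let $\beta_t$ be as above with $n=1$, $\hat a_t=V_t^{-1}\sum_{k=1}^{t-1}x_kz_k$ and $\mathcal Y_t^p=\{u\in\mathcal X:\hat a_t^\top u+\beta_t\|u\|_{V_t^{-1}}\le b\}$. Let $x_*$ maximize $u\mapsto\theta^\top u$ over $\{u\in\mathcal X:a^\top u\le b\}$, with $\theta^\top x_*>0$.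 If the actions follow the same OPLB rule with this $\mathcal Y_t^p$ and $\kappa=1+2S_\theta/b$, then with probability at least $1-\delta$ $$R_T\le(1+\kappa)\,\beta_T\sqrt{2dT\log\Bigl(1+\frac{T}{\lambda d}\Bigr)}.$$ -/

import Mathlib

open MeasureTheory
open scoped Matrix

namespace SafeLinearBandit

noncomputable section

/-- The regularized design matrix `V_t = ∑_{k=1}^{t-1} x_k x_kᵀ + lam • I`
of a sequence of actions `x_1, x_2, …`. -/
def designMatrix {d : ℕ} (lam : ℝ) (x : ℕ → EuclideanSpace ℝ (Fin d)) (t : ℕ) :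
    Matrix (Fin d) (Fin d) ℝ :=
  (∑ k ∈ Finset.Ico 1 t, Matrix.vecMulVec (x k).ofLp (x k).ofLp)
    + lam • (1 : Matrix (Fin d) (Fin d) ℝ)

/-- The weighted norm `‖x‖_M = √(xᵀ M x)`. -/
def weightedNorm {d : ℕ} (M : Matrix (Fin d) (Fin d) ℝ) (x : EuclideanSpace ℝ (Fin d)) : ℝ :=
  Real.sqrt (x.ofLp ⬝ᵥ (M *ᵥ x.ofLp))

/-- The width `‖u‖_{V_t⁻¹}` of the point `u` at round `t`. -/
def width {d : ℕ} (lam : ℝ) (x : ℕ → EuclideanSpace ℝ (Fin d)) (t : ℕ)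
    (u : EuclideanSpace ℝ (Fin d)) : ℝ :=
  weightedNorm (designMatrix lam x t)⁻¹ u

/-- The regularized least-squares estimator `V_t⁻¹ ∑_{k=1}^{t-1} x_k y_k`
from the scalar observations `y_1, …, y_{t-1}`. -/
def ridgeEstimator {d : ℕ} (lam : ℝ) (x : ℕ → EuclideanSpace ℝ (Fin d)) (y : ℕ → ℝ) (t : ℕ) :
    EuclideanSpace ℝ (Fin d) :=
  WithLp.toLp 2
    ((designMatrix lam x t)⁻¹ *ᵥ (∑ k ∈ Finset.Ico 1 t, y k • (x k).ofLp))

/-- The estimator of the constraint matrix: its `i`-th row is the regularized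
least-squares estimator from the `i`-th coordinates of the vector observations. -/
def ridgeMatrix {d n : ℕ} (lam : ℝ) (x : ℕ → EuclideanSpace ℝ (Fin d))
    (z : ℕ → EuclideanSpace ℝ (Fin n)) (t : ℕ) : Matrix (Fin n) (Fin d) ℝ :=
  Matrix.of fun i => (ridgeEstimator lam x (fun k => z k i) t).ofLp

/-- The action of a matrix on Euclidean vectors. -/
def applyMat {d n : ℕ} (A : Matrix (Fin n) (Fin d) ℝ) (u : EuclideanSpace ℝ (Fin d)) :
    EuclideanSpace ℝ (Fin n) :=
  WithLp.toLp 2 (A *ᵥ u.ofLp)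

/-- The confidence radius
`β_t = ρ √(d log ((1 + (t - 1) / lam) / (δ / (n + 1)))) + √lam S`,
where `n` is the number of rows of the constraint. -/
def confRadius (d n : ℕ) (ρ lam δ S : ℝ) (t : ℕ) : ℝ :=
  ρ * Real.sqrt ((d : ℝ) * Real.log ((1 + ((t : ℝ) - 1) / lam) / (δ / ((n : ℝ) + 1))))
    + Real.sqrt lam * S

/-- The reward observations `y_t = ⟨θ, x_t⟩ + ε_t`; also the observations
of a single linear constraint function. -/
def scalarObs {d : ℕ} (θ : EuclideanSpace ℝ (Fin d)) (x : ℕ → EuclideanSpace ℝ (Fin d))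
    (ε : ℕ → ℝ) (t : ℕ) : ℝ :=
  inner ℝ θ (x t) + ε t

/-- The constraint observations `z_t = A x_t + η_t`. -/
def vectorObs {d n : ℕ} (A : Matrix (Fin n) (Fin d) ℝ) (x : ℕ → EuclideanSpace ℝ (Fin d))
    (η : ℕ → EuclideanSpace ℝ (Fin n)) (t : ℕ) : EuclideanSpace ℝ (Fin n) :=
  applyMat A (x t) + η t

/-- The feasible set `{u ∈ 𝒳 : A u ∈ 𝒢}`. -/
def feasibleSet {d n : ℕ} (X : Set (EuclideanSpace ℝ (Fin d))) (A : Matrix (Fin n) (Fin d) ℝ)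
    (G : Set (EuclideanSpace ℝ (Fin n))) : Set (EuclideanSpace ℝ (Fin d)) :=
  {u | u ∈ X ∧ applyMat A u ∈ G}

/-- The feasible set `{u ∈ 𝒳 : aᵀ u ≤ b}` of a single linear constraint. -/
def linFeasibleSet {d : ℕ} (X : Set (EuclideanSpace ℝ (Fin d))) (a : EuclideanSpace ℝ (Fin d))
    (b : ℝ) : Set (EuclideanSpace ℝ (Fin d)) :=
  {u | u ∈ X ∧ inner ℝ a u ≤ b}

/-- The pessimistic set
`{u ∈ 𝒳 : Â_t u + β_t ‖u‖_{V_t⁻¹} 𝔹_∞ ⊆ 𝒢}`, where `𝔹_∞` is the unit ball of the sup norm. -/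
def pessimisticSet {d n : ℕ} (X : Set (EuclideanSpace ℝ (Fin d)))
    (G : Set (EuclideanSpace ℝ (Fin n))) (lam : ℝ) (β : ℕ → ℝ)
    (x : ℕ → EuclideanSpace ℝ (Fin d)) (z : ℕ → EuclideanSpace ℝ (Fin n)) (t : ℕ) :
    Set (EuclideanSpace ℝ (Fin d)) :=
  {u | u ∈ X ∧ ∀ v : EuclideanSpace ℝ (Fin n), (∀ i, |v i| ≤ 1) →
    applyMat (ridgeMatrix lam x z t) u + (β t * width lam x t u) • v ∈ G}

/-- The pessimistic set `{u ∈ 𝒳 : â_tᵀ u + β_t ‖u‖_{V_t⁻¹} ≤ b}` of a single linear constraint. -/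
def linPessimisticSet {d : ℕ} (X : Set (EuclideanSpace ℝ (Fin d))) (b : ℝ) (lam : ℝ) (β : ℕ → ℝ)
    (x : ℕ → EuclideanSpace ℝ (Fin d)) (z : ℕ → ℝ) (t : ℕ) : Set (EuclideanSpace ℝ (Fin d)) :=
  {u | u ∈ X ∧ inner ℝ (ridgeEstimator lam x z t) u + β t * width lam x t u ≤ b}

/-- The OPLB rule: at each round `t ∈ {1, …, T}` the action `x_t` is a maximizer of
`u ↦ θ̂_tᵀ u + κ β_t ‖u‖_{V_t⁻¹}` over the pessimistic set `P t`. -/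
def PlaysOPLB {d : ℕ} (T : ℕ) (P : ℕ → Set (EuclideanSpace ℝ (Fin d))) (lam κ : ℝ) (β : ℕ → ℝ)
    (x : ℕ → EuclideanSpace ℝ (Fin d)) (y : ℕ → ℝ) : Prop :=
  ∀ t ∈ Finset.Icc 1 T, x t ∈ P t ∧
    IsMaxOn (fun u => inner ℝ (ridgeEstimator lam x y t) u + κ * β t * width lam x t u) (P t) (x t)

/-- The regret `R_T = ∑_{t=1}^T ⟨θ, x_* - x_t⟩`. -/
def regret {d : ℕ} (T : ℕ) (θ xstar : EuclideanSpace ℝ (Fin d))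
    (x : ℕ → EuclideanSpace ℝ (Fin d)) : ℝ :=
  ∑ t ∈ Finset.Icc 1 T, inner ℝ θ (xstar - x t)

/-- The σ-algebra generated by `x_1, …, x_t` and `ξ_1, …, ξ_{t-1}`. -/
@[reducible] def history {Ω : Type*} {d : ℕ} (x : ℕ → Ω → EuclideanSpace ℝ (Fin d)) (ξ : ℕ → Ω → ℝ) (t : ℕ) :
    MeasurableSpace Ω :=
  (⨆ k ∈ Finset.Icc 1 t, MeasurableSpace.comap (x k) inferInstance) ⊔
    (⨆ k ∈ Finset.Ico 1 t, MeasurableSpace.comap (ξ k) inferInstance)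

/-- The scalar noise `ξ` is, at each round `t ∈ {1, …, T}`, centered and `ρ`-subgaussian
conditionally on `x_1, ξ_1, …, ξ_{t-1}, x_t`. The integrability of `exp (s ξ_t)`, which
the bound on its conditional expectation presupposes, is stated explicitly. -/
def IsSubgaussianNoise {Ω : Type*} [MeasurableSpace Ω] (μ : Measure Ω) {d : ℕ} (T : ℕ)
    (x : ℕ → Ω → EuclideanSpace ℝ (Fin d)) (ρ : ℝ) (ξ : ℕ → Ω → ℝ) : Prop :=
  ∀ t ∈ Finset.Icc 1 T,
    μ[ξ t | history x ξ t] =ᵐ[μ] 0 ∧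
    ∀ s : ℝ, Integrable (fun ω => Real.exp (s * ξ t ω)) μ ∧
      μ[fun ω => Real.exp (s * ξ t ω) | history x ξ t]
        ≤ᵐ[μ] fun _ => Real.exp (s ^ 2 * ρ ^ 2 / 2)

end

end SafeLinearBandit

/-! The proof combines optimism on a confidence event with a shrinking argument that makes the
optimum pessimistically feasible.

Concentration. With `s_t` the noise sum, `exp(‖s_t‖² / (2σ²)) / √(det V_t / λ^d)`, in the norm of
`V_t⁻¹`, is a nonnegative supermartingale started at 1. It is handled one step at a time: its ratio
is a one-dimensional Gaussian average of factors `exp(gξ_t - g²σ²/2)` with `g` measurable in the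
history (`ofReal_selfNormalizedExp_succ`), and each factor has conditional mean at most 1
(`lintegral_mul_exp_le`). A maximal inequality bounds it for all rounds at once. Applied to the
reward and the `n` constraint coordinates at level `δ/(n+1)`, it shows that off an event of
probability at most `δ` every ridge estimate errs by at most `β_t‖u‖` in every direction `u`.

Feasibility. At `x_*`, estimation error and pessimistic margin together move each constraint
coordinate by at most `2β_t‖x_*‖`. Shrinking `x_*` by `α = (1 + 2qβ_t‖x_*‖)⁻¹` absorbs this, with `q
= √n/r` for a convex set containing the ball of radius `r` and `q = 1/b` for a half-space.

Optimism. The bonus factor `κ = 1 + 2q S_θ` is chosen so that the optimistic value of `αx_*` is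
still at least `θᵀx_*`: one unit pays for the estimation error, the rest for the shrinking. Hence
each round costs at most `(1+κ)β_t‖x_t‖`, and Cauchy–Schwarz with the elliptical potential bound
sums the widths. -/

namespace SafeLinearBandit

/-! ### Rank-one updates and determinants of positive definite matrices. -/

section LinearAlgebra

variable {ι : Type*} [Fintype ι] [DecidableEq ι] {M : Matrix ι ι ℝ}

theorem dotProduct_inv_mulVec_comm (hM : M.IsHermitian) (u v : ι → ℝ) :
    u ⬝ᵥ (M⁻¹ *ᵥ v) = v ⬝ᵥ (M⁻¹ *ᵥ u) := by
  have h : (M⁻¹)ᵀ = M⁻¹ := by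
    rw [← Matrix.conjTranspose_eq_transpose_of_trivial, hM.inv.eq]
  rw [Matrix.dotProduct_mulVec, dotProduct_comm, ← Matrix.mulVec_transpose, h]

theorem dotProduct_inv_mulVec_self_nonneg (hM : M.PosDef) (u : ι → ℝ) :
    0 ≤ u ⬝ᵥ (M⁻¹ *ᵥ u) := by
  simpa using hM.inv.posSemidef.dotProduct_mulVec_nonneg u

/-- Cauchy–Schwarz for the form of `M⁻¹`: its value at `u + c • v` is a nonnegative quadratic in
`c`, so the discriminant is nonpositive. -/
theorem abs_dotProduct_inv_mulVec_le (hM : M.PosDef) (u v : ι → ℝ) :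
    |u ⬝ᵥ (M⁻¹ *ᵥ v)| ≤ √(u ⬝ᵥ (M⁻¹ *ᵥ u)) * √(v ⬝ᵥ (M⁻¹ *ᵥ v)) := by
  have key : ∀ c : ℝ, 0 ≤ (v ⬝ᵥ (M⁻¹ *ᵥ v)) * (c * c) + (2 * (u ⬝ᵥ (M⁻¹ *ᵥ v))) * c
      + u ⬝ᵥ (M⁻¹ *ᵥ u) := by
    intro c
    have h := dotProduct_inv_mulVec_self_nonneg hM (u + c • v)
    have h2 := dotProduct_inv_mulVec_comm hM.isHermitian v u
    simp only [Matrix.mulVec_add, Matrix.mulVec_smul, add_dotProduct, dotProduct_add,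
      smul_dotProduct, dotProduct_smul, smul_eq_mul] at h
    rw [h2] at h
    linarith
  have hd := discrim_le_zero key
  rw [discrim] at hd
  rw [← Real.sqrt_mul (dotProduct_inv_mulVec_self_nonneg hM u)]
  apply Real.abs_le_sqrt
  nlinarith

theorem posDef_add_vecMulVec {κ : Type*} [Fintype κ] {N : Matrix κ κ ℝ} (hN : N.PosDef)
    (x : κ → ℝ) : (N + Matrix.vecMulVec x x).PosDef :=
  hN.add_posSemidef (by simpa using Matrix.posSemidef_vecMulVec_self_star x)

/-- The matrix determinant lemma. It turns squared widths into determinant ratios, for both the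
potential bound and the normalization of the exponential process. -/
theorem det_add_vecMulVec_self (hM : M.PosDef) (x : ι → ℝ) :
    (M + Matrix.vecMulVec x x).det = M.det * (1 + x ⬝ᵥ (M⁻¹ *ᵥ x)) := by
  rw [Matrix.vecMulVec_eq Unit, Matrix.det_add_replicateCol_mul_replicateRow
    (isUnit_iff_ne_zero.2 hM.det_pos.ne')]
  congr 1
  rw [Matrix.det_unique]
  simp [Matrix.mul_apply, Matrix.mulVec, dotProduct, Finset.sum_mul, Finset.mul_sum]
  rw [Finset.sum_comm]
  simp [mul_assoc]

/-- The quadratic form of the inverse under a rank-one update (Sherman-Morrison). -/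
theorem quadForm_inv_add_vecMulVec (hM : M.PosDef) (x s : ι → ℝ) (c : ℝ) :
    (s + c • x) ⬝ᵥ ((M + Matrix.vecMulVec x x)⁻¹ *ᵥ (s + c • x)) =
      s ⬝ᵥ (M⁻¹ *ᵥ s) + (2 * (x ⬝ᵥ (M⁻¹ *ᵥ s)) * c + (x ⬝ᵥ (M⁻¹ *ᵥ x)) * c ^ 2
        - (x ⬝ᵥ (M⁻¹ *ᵥ s)) ^ 2) / (1 + x ⬝ᵥ (M⁻¹ *ᵥ x)) := by
  have hw := dotProduct_inv_mulVec_self_nonneg hM x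
  set w := x ⬝ᵥ (M⁻¹ *ᵥ x) with hwdef
  have hw1 : 1 + w ≠ 0 := by positivity
  set y := s + c • x with hy
  have hMM : ∀ v, M *ᵥ (M⁻¹ *ᵥ v) = v := fun v => by
    rw [Matrix.mulVec_mulVec, Matrix.mul_nonsing_inv _ (isUnit_iff_ne_zero.2 hM.det_pos.ne'),
      Matrix.one_mulVec]
  -- The Sherman–Morrison vector is verified to solve the updated system; invertibility then
  -- identifies it with the inverse applied to `y`.
  have hsol : (M + Matrix.vecMulVec x x) *ᵥ
      (M⁻¹ *ᵥ y - ((x ⬝ᵥ (M⁻¹ *ᵥ y)) / (1 + w)) • (M⁻¹ *ᵥ x)) = y := by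
    simp only [Matrix.add_mulVec, Matrix.mulVec_sub, Matrix.mulVec_smul, hMM,
      Matrix.vecMulVec_mulVec, ← hwdef]
    ext i
    simp
    field_simp
    ring
  have hinv : (M + Matrix.vecMulVec x x)⁻¹ *ᵥ y =
      M⁻¹ *ᵥ y - ((x ⬝ᵥ (M⁻¹ *ᵥ y)) / (1 + w)) • (M⁻¹ *ᵥ x) := by
    conv_lhs => rw [← hsol]
    rw [Matrix.mulVec_mulVec, Matrix.nonsing_inv_mul _
      (isUnit_iff_ne_zero.2 (posDef_add_vecMulVec hM x).det_pos.ne'), Matrix.one_mulVec]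
  rw [hinv, dotProduct_sub, dotProduct_smul, dotProduct_inv_mulVec_comm hM.isHermitian y x]
  have h2 := dotProduct_inv_mulVec_comm hM.isHermitian s x
  simp only [hy, Matrix.mulVec_add, Matrix.mulVec_smul, add_dotProduct, dotProduct_add,
      smul_dotProduct, dotProduct_smul, smul_eq_mul, h2, ← hwdef]
  field_simp
  ring

/-- AM–GM on the eigenvalues. -/
theorem det_le_trace_div_card_pow [Nonempty ι] (hM : M.PosSemidef) :
    M.det ≤ (M.trace / Fintype.card ι) ^ Fintype.card ι := by
  have hc : (0 : ℝ) < Fintype.card ι := by exact_mod_cast Fintype.card_pos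
  have := Real.geom_mean_le_arith_mean Finset.univ (fun _ : ι => (1 : ℝ)) hM.isHermitian.eigenvalues
    (fun _ _ => zero_le_one) (by simpa using Fintype.card_pos) (fun i _ => hM.eigenvalues_nonneg i)
  have hdet : M.det = ∏ i, hM.isHermitian.eigenvalues i := by
    simpa using hM.isHermitian.det_eq_prod_eigenvalues
  have htr : M.trace = ∑ i, hM.isHermitian.eigenvalues i := by
    simpa using hM.isHermitian.trace_eq_sum_eigenvalues
  simp only [Real.rpow_one, one_mul, Finset.sum_const, Finset.card_univ, nsmul_eq_mul, mul_one,
    ← hdet, ← htr] at this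
  have h0 : 0 ≤ M.det := hM.det_nonneg
  calc M.det = (M.det ^ ((Fintype.card ι : ℝ)⁻¹)) ^ Fintype.card ι :=
        (Real.rpow_inv_natCast_pow h0 Fintype.card_ne_zero).symm
    _ ≤ _ := by gcongr

end LinearAlgebra

/-! ### The design matrix, widths and the elliptical potential. -/

section Design

variable {d : ℕ} {lam : ℝ} (x : ℕ → EuclideanSpace ℝ (Fin d))

theorem designMatrix_one : designMatrix lam x 1 = lam • 1 := by
  simp [designMatrix]

theorem designMatrix_succ {t : ℕ} (ht : 1 ≤ t) :
    designMatrix lam x (t + 1) =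
      designMatrix lam x t + Matrix.vecMulVec (x t).ofLp (x t).ofLp := by
  simp only [designMatrix, Finset.sum_Ico_succ_top ht]
  abel

theorem designMatrix_posDef (hlam : 0 < lam) (t : ℕ) : (designMatrix lam x t).PosDef := by
  refine Matrix.PosDef.posSemidef_add (Matrix.posSemidef_sum _ fun k _ => ?_)
    (Matrix.PosDef.one.smul hlam)
  simpa using Matrix.posSemidef_vecMulVec_self_star (x k).ofLp

theorem det_designMatrix_one : (designMatrix lam x 1).det = lam ^ d := by
  simp [designMatrix_one]

theorem trace_designMatrix (t : ℕ) :
    (designMatrix lam x t).trace = ∑ k ∈ Finset.Ico 1 t, ‖x k‖ ^ 2 + d * lam := by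
  simp only [designMatrix, Matrix.trace_add, Matrix.trace_sum, Matrix.trace_vecMulVec,
    EuclideanSpace.real_norm_sq_eq, dotProduct, ← pow_two]
  simp [mul_comm]

theorem det_designMatrix_le (hlam : 0 < lam) (hd : d ≠ 0) {t : ℕ} (ht : 1 ≤ t)
    (hx : ∀ k ∈ Finset.Ico 1 t, ‖x k‖ ≤ 1) :
    (designMatrix lam x t).det ≤ (lam * (1 + ((t : ℝ) - 1) / (lam * d))) ^ d := by
  have : Nonempty (Fin d) := Fin.pos_iff_nonempty.1 (Nat.pos_of_ne_zero hd)
  have hd' : (0 : ℝ) < d := by exact_mod_cast Nat.pos_of_ne_zero hd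
  refine (det_le_trace_div_card_pow (designMatrix_posDef x hlam t).posSemidef).trans ?_
  have h0 := (designMatrix_posDef x hlam t).posSemidef.trace_nonneg
  have hsum : ∑ k ∈ Finset.Ico 1 t, ‖x k‖ ^ 2 ≤ (t : ℝ) - 1 := by
    calc ∑ k ∈ Finset.Ico 1 t, ‖x k‖ ^ 2 ≤ ∑ k ∈ Finset.Ico 1 t, (1 : ℝ) :=
          Finset.sum_le_sum fun k hk => pow_le_one₀ (norm_nonneg _) (hx k hk)
      _ = _ := by simp [Nat.cast_sub ht]
  rw [Fintype.card_fin]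
  refine pow_le_pow_left₀ (by positivity) ?_ d
  rw [trace_designMatrix, div_le_iff₀ hd']
  have : lam * (1 + ((t : ℝ) - 1) / (lam * d)) * d = d * lam + ((t : ℝ) - 1) := by
    field_simp
  linarith

theorem width_nonneg (t : ℕ) (u : EuclideanSpace ℝ (Fin d)) : 0 ≤ width lam x t u :=
  Real.sqrt_nonneg _

theorem width_sq (hlam : 0 < lam) (t : ℕ) (u : EuclideanSpace ℝ (Fin d)) :
    width lam x t u ^ 2 = u.ofLp ⬝ᵥ ((designMatrix lam x t)⁻¹ *ᵥ u.ofLp) :=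
  Real.sq_sqrt (dotProduct_inv_mulVec_self_nonneg (designMatrix_posDef x hlam t) _)

theorem width_smul (t : ℕ) {c : ℝ} (hc : 0 ≤ c) (u : EuclideanSpace ℝ (Fin d)) :
    width lam x t (c • u) = c * width lam x t u := by
  simp only [width, weightedNorm, WithLp.ofLp_smul, Matrix.mulVec_smul, smul_dotProduct,
    dotProduct_smul, smul_eq_mul]
  rw [← mul_assoc, Real.sqrt_mul (mul_nonneg hc hc), Real.sqrt_mul_self hc]

theorem det_designMatrix_succ (hlam : 0 < lam) {t : ℕ} (ht : 1 ≤ t) :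
    (designMatrix lam x (t + 1)).det =
      (designMatrix lam x t).det * (1 + width lam x t (x t) ^ 2) := by
  rw [designMatrix_succ x ht, det_add_vecMulVec_self (designMatrix_posDef x hlam t),
    width_sq x hlam]

/-- `xᵀ M x ≥ lam ‖x‖²`, dually for the inverse. -/
theorem lam_mul_width_sq_le (hlam : 0 < lam) (t : ℕ) (u : EuclideanSpace ℝ (Fin d)) :
    lam * width lam x t u ^ 2 ≤ ‖u‖ ^ 2 := by
  rw [width_sq x hlam]
  set M := designMatrix lam x t with hM
  have hMp : M.PosDef := designMatrix_posDef x hlam t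
  set y := M⁻¹ *ᵥ u.ofLp with hy
  have hMy : M *ᵥ y = u.ofLp := by
    rw [hy, Matrix.mulVec_mulVec, Matrix.mul_nonsing_inv _
      (isUnit_iff_ne_zero.2 hMp.det_pos.ne'), Matrix.one_mulVec]
  have hps : (∑ k ∈ Finset.Ico 1 t, Matrix.vecMulVec (x k).ofLp (x k).ofLp).PosSemidef :=
    Matrix.posSemidef_sum _ fun k _ => by
      simpa using Matrix.posSemidef_vecMulVec_self_star (x k).ofLp
  -- This is `V_t ≥ λI` tested on `y = V_t⁻¹u`. Combined with `‖u - λy‖² ≥ 0` it gives `λ uᵀy ≤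
  -- ‖u‖²`.
  have h1 : lam * (y ⬝ᵥ y) ≤ y ⬝ᵥ u.ofLp := by
    rw [← hMy, hM, designMatrix, Matrix.add_mulVec, dotProduct_add, Matrix.smul_mulVec,
      Matrix.one_mulVec, dotProduct_smul, smul_eq_mul]
    have := hps.dotProduct_mulVec_nonneg y
    simp only [star_trivial] at this
    linarith
  have h2 : 0 ≤ (u.ofLp - lam • y) ⬝ᵥ (u.ofLp - lam • y) := by
    simpa using dotProduct_self_star_nonneg (u.ofLp - lam • y)
  have h3 : ‖u‖ ^ 2 = u.ofLp ⬝ᵥ u.ofLp := by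
    simp only [EuclideanSpace.real_norm_sq_eq, dotProduct, ← pow_two]
  simp only [sub_dotProduct, dotProduct_sub, smul_dotProduct, dotProduct_smul, smul_eq_mul] at h2
  rw [dotProduct_comm u.ofLp y] at h2 ⊢
  rw [h3]
  nlinarith

theorem sqrt_lam_mul_width_le (hlam : 0 < lam) (t : ℕ) (u : EuclideanSpace ℝ (Fin d)) :
    √lam * width lam x t u ≤ ‖u‖ := by
  refine abs_le_of_sq_le_sq' ?_ (norm_nonneg _) |>.2
  rw [mul_pow, Real.sq_sqrt hlam.le]
  exact lam_mul_width_sq_le x hlam t u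

/-- The elliptical potential bound. -/
theorem sum_width_sq_le (hlam : 1 ≤ lam) (hd : d ≠ 0) {T : ℕ}
    (hx : ∀ k ∈ Finset.Icc 1 T, ‖x k‖ ≤ 1) :
    ∑ t ∈ Finset.Icc 1 T, width lam x t (x t) ^ 2 ≤
      2 * d * Real.log (1 + T / (lam * d)) := by
  have hl0 : 0 < lam := zero_lt_one.trans_le hlam
  have hterm : ∀ t ∈ Finset.Icc 1 T, width lam x t (x t) ^ 2 ≤
      2 * (Real.log (designMatrix lam x (t + 1)).det - Real.log (designMatrix lam x t).det) := by
    intro t ht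
    -- Here `λ ≥ 1` is essential: `q/2 ≤ log(1+q)` is derived below for `0 ≤ q ≤ 1`, and `log(1+q)`
    -- is the telescoping increment of `log det V_t`.
    have hw1 : width lam x t (x t) ^ 2 ≤ 1 := by
      have h1 := lam_mul_width_sq_le x hl0 t (x t)
      have h2 : ‖x t‖ ^ 2 ≤ 1 := pow_le_one₀ (norm_nonneg _) (hx t ht)
      nlinarith [sq_nonneg (width lam x t (x t))]
    have hw0 := sq_nonneg (width lam x t (x t))
    rw [det_designMatrix_succ x hl0 (Finset.mem_Icc.1 ht).1,
      Real.log_mul (designMatrix_posDef x hl0 t).det_pos.ne' (by positivity), add_sub_cancel_left]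
    set q := width lam x t (x t) ^ 2
    have h := Real.one_sub_inv_le_log_of_pos (show 0 < 1 + q by positivity)
    have h2 : q / 2 ≤ 1 - (1 + q)⁻¹ := by
      rw [← sub_nonneg]
      have : 1 - (1 + q)⁻¹ - q / 2 = q * (1 - q) / (2 * (1 + q)) := by
        field_simp
        ring
      rw [this]
      have : 0 ≤ 1 - q := by linarith
      positivity
    linarith
  refine (Finset.sum_le_sum hterm).trans ?_
  rw [← Finset.mul_sum, ← Finset.Ico_add_one_right_eq_Icc,
    Finset.sum_Ico_sub (fun t => Real.log (designMatrix lam x t).det) (by omega),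
    det_designMatrix_one]
  -- `V_{T+1}` is the design matrix containing all of `x_1, …, x_T`, hence `T` rather than `T - 1`
  -- in the logarithm.
  have hle := det_designMatrix_le x hl0 hd (t := T + 1) (by omega) (by
    simpa only [Finset.Ico_add_one_right_eq_Icc] using hx)
  have hlog := Real.log_le_log (designMatrix_posDef x hl0 (T + 1)).det_pos hle
  push_cast at hlog
  rw [add_sub_cancel_right, Real.log_pow, Real.log_mul hl0.ne' (by positivity)] at hlog
  rw [Real.log_pow]
  nlinarith

end Design

/-! ### Conditional exponential moments, Gaussian mixing and a maximal inequality. -/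

open ProbabilityTheory Filter Topology
open scoped ENNReal

section PlugIn

variable {Ω : Type*} {m m₀ : MeasurableSpace Ω} {μ : Measure Ω} {ξ : Ω → ℝ} {σ : ℝ}

/-- For a fixed exponent, the conditional moment bound is a domination of measures on `m`. In this
form it extends at once to every nonnegative `m`-measurable weight. -/
theorem trim_withDensity_exp_le [IsFiniteMeasure μ] (hm : m ≤ m₀) {s : ℝ}
    (hint : Integrable (fun ω => Real.exp (s * ξ ω)) μ)
    (hsub : μ[fun ω => Real.exp (s * ξ ω) | m] ≤ᵐ[μ] fun _ => Real.exp (s ^ 2 * σ ^ 2 / 2)) :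
    (μ.withDensity fun ω => ENNReal.ofReal (Real.exp (s * ξ ω - s ^ 2 * σ ^ 2 / 2))).trim hm ≤
      μ.trim hm := by
  refine Measure.le_iff.2 fun A hA => ?_
  rw [trim_measurableSet_eq hm hA, trim_measurableSet_eq hm hA, withDensity_apply _ (hm A hA)]
  have hfun : (fun ω => Real.exp (s * ξ ω - s ^ 2 * σ ^ 2 / 2)) =
      fun ω => Real.exp (-(s ^ 2 * σ ^ 2 / 2)) * Real.exp (s * ξ ω) := by
    ext ω
    rw [← Real.exp_add]
    ring_nf
  have hint2 : Integrable (fun ω => Real.exp (s * ξ ω - s ^ 2 * σ ^ 2 / 2)) μ := by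
    rw [hfun]
    exact hint.const_mul _
  rw [← ofReal_integral_eq_lintegral_ofReal hint2.integrableOn
    (ae_of_all _ fun _ => (Real.exp_pos _).le), hfun, integral_const_mul,
    ← setIntegral_condExp hm hint hA]
  have hle : ∫ ω in A, (μ[fun ω => Real.exp (s * ξ ω) | m]) ω ∂μ ≤
      ∫ _ in A, Real.exp (s ^ 2 * σ ^ 2 / 2) ∂μ :=
    integral_mono_ae integrable_condExp.integrableOn (integrable_const _) (ae_restrict_of_ae hsub)
  rw [setIntegral_const, smul_eq_mul] at hle
  refine ENNReal.ofReal_le_of_le_toReal ?_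
  calc _ ≤ Real.exp (-(s ^ 2 * σ ^ 2 / 2)) * (μ.real A * Real.exp (s ^ 2 * σ ^ 2 / 2)) := by
        gcongr
    _ = μ.real A := by
        rw [mul_left_comm, ← Real.exp_add]
        simp

/-- A conditional exponential moment bound remains valid for a random exponent that is measurable
with respect to the conditioning σ-algebra. -/
theorem lintegral_mul_exp_le [IsFiniteMeasure μ] (hm : m ≤ m₀) (hξ : Measurable ξ)
    (hsub : ∀ s : ℝ, Integrable (fun ω => Real.exp (s * ξ ω)) μ ∧
      μ[fun ω => Real.exp (s * ξ ω) | m] ≤ᵐ[μ] fun _ => Real.exp (s ^ 2 * σ ^ 2 / 2))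
    {g : Ω → ℝ} (hg : Measurable[m] g) {Y : Ω → ℝ≥0∞} (hY : Measurable[m] Y) :
    ∫⁻ ω, Y ω * ENNReal.ofReal (Real.exp (g ω * ξ ω - g ω ^ 2 * σ ^ 2 / 2)) ∂μ ≤
      ∫⁻ ω, Y ω ∂μ := by
  have hconst : ∀ (s : ℝ) (Z : Ω → ℝ≥0∞), Measurable[m] Z →
      ∫⁻ ω, Z ω * ENNReal.ofReal (Real.exp (s * ξ ω - s ^ 2 * σ ^ 2 / 2)) ∂μ ≤
        ∫⁻ ω, Z ω ∂μ := by
    intro s Z hZ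
    have h := lintegral_mono' (trim_withDensity_exp_le hm (hsub s).1 (hsub s).2) (le_refl Z)
    rw [lintegral_trim hm hZ, lintegral_trim hm hZ, lintegral_withDensity_eq_lintegral_mul _
      (by fun_prop) (hZ.mono hm le_rfl)] at h
    simpa [mul_comm] using h
  -- The level sets of a simple exponent lie in `m`, so the fixed-exponent case applies to `Y`
  -- restricted to each of them.
  have hsimple : ∀ f : @SimpleFunc Ω m ℝ,
      ∫⁻ ω, Y ω * ENNReal.ofReal (Real.exp (f ω * ξ ω - f ω ^ 2 * σ ^ 2 / 2)) ∂μ ≤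
        ∫⁻ ω, Y ω ∂μ := by
    intro f
    have hfib : ∀ c, MeasurableSet[m] (f ⁻¹' {c}) := fun c => @SimpleFunc.measurableSet_fiber Ω ℝ m f c
    have hdecomp : ∀ (Z : Ω → ℝ≥0∞) (ω : Ω),
        Z ω = ∑ c ∈ @SimpleFunc.range Ω ℝ m f, (f ⁻¹' {c}).indicator Z ω := by
      intro Z ω
      rw [Finset.sum_eq_single (f ω)]
      · simp
      · intro c _ hc
        exact Set.indicator_of_notMem (fun h => hc (by simpa using h.symm)) _
      · intro h
        exact absurd (@SimpleFunc.mem_range_self Ω ℝ m f ω) h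
    have hind : ∀ c, Measurable[m] ((f ⁻¹' {c}).indicator Y) := fun c => hY.indicator (hfib c)
    calc ∫⁻ ω, Y ω * ENNReal.ofReal (Real.exp (f ω * ξ ω - f ω ^ 2 * σ ^ 2 / 2)) ∂μ
        = ∫⁻ ω, ∑ c ∈ @SimpleFunc.range Ω ℝ m f, (f ⁻¹' {c}).indicator Y ω *
            ENNReal.ofReal (Real.exp (c * ξ ω - c ^ 2 * σ ^ 2 / 2)) ∂μ := by
          refine lintegral_congr fun ω => ?_
          conv_lhs => rw [hdecomp Y ω, Finset.sum_mul]
          refine Finset.sum_congr rfl fun c _ => ?_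
          by_cases h : ω ∈ f ⁻¹' {c}
          · rw [show f ω = c by simpa using h]
          · simp [Set.indicator_of_notMem h]
      _ = ∑ c ∈ @SimpleFunc.range Ω ℝ m f, ∫⁻ ω, (f ⁻¹' {c}).indicator Y ω *
            ENNReal.ofReal (Real.exp (c * ξ ω - c ^ 2 * σ ^ 2 / 2)) ∂μ := by
          refine lintegral_finsetSum _ fun c _ => ?_
          exact ((hind c).mono hm le_rfl).mul (by fun_prop)
      _ ≤ ∑ c ∈ @SimpleFunc.range Ω ℝ m f, ∫⁻ ω, (f ⁻¹' {c}).indicator Y ω ∂μ :=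
          Finset.sum_le_sum fun c _ => hconst c _ (hind c)
      _ = ∫⁻ ω, Y ω ∂μ := by
          rw [← lintegral_finsetSum _ fun c _ => (hind c).mono hm le_rfl]
          exact lintegral_congr fun ω => (hdecomp Y ω).symm
  have hgs : StronglyMeasurable[m] g := hg.stronglyMeasurable
  have hlim : ∀ ω, Tendsto (fun n => Y ω * ENNReal.ofReal
      (Real.exp (hgs.approx n ω * ξ ω - hgs.approx n ω ^ 2 * σ ^ 2 / 2))) atTop
      (𝓝 (Y ω * ENNReal.ofReal (Real.exp (g ω * ξ ω - g ω ^ 2 * σ ^ 2 / 2)))) := by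
    intro ω
    refine ENNReal.Tendsto.const_mul ?_ (Or.inl ?_)
    · have hcont : Continuous fun a : ℝ =>
          ENNReal.ofReal (Real.exp (a * ξ ω - a ^ 2 * σ ^ 2 / 2)) :=
        ENNReal.continuous_ofReal.comp (by fun_prop)
      exact (hcont.tendsto _).comp (hgs.tendsto_approx ω)
    · simpa using Real.exp_pos _
  -- Fatou's lemma passes from simple exponents to `g`; only an upper bound is wanted, so no
  -- domination is needed.
  calc ∫⁻ ω, Y ω * ENNReal.ofReal (Real.exp (g ω * ξ ω - g ω ^ 2 * σ ^ 2 / 2)) ∂μ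
      = ∫⁻ ω, liminf (fun n => Y ω * ENNReal.ofReal
          (Real.exp (hgs.approx n ω * ξ ω - hgs.approx n ω ^ 2 * σ ^ 2 / 2))) atTop ∂μ :=
        lintegral_congr fun ω => (hlim ω).liminf_eq.symm
    _ ≤ liminf (fun n => ∫⁻ ω, Y ω * ENNReal.ofReal
          (Real.exp (hgs.approx n ω * ξ ω - hgs.approx n ω ^ 2 * σ ^ 2 / 2)) ∂μ) atTop := by
        refine lintegral_liminf_le fun n => ?_
        have h1 : Measurable (hgs.approx n) :=
          (@SimpleFunc.measurable Ω ℝ m _ (hgs.approx n)).mono hm le_rfl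
        exact (hY.mono hm le_rfl).mul (by fun_prop)
    _ ≤ ∫⁻ ω, Y ω ∂μ := by
        refine liminf_le_of_le (by isBoundedDefault) fun b hb => ?_
        obtain ⟨n, hn⟩ := hb.exists
        exact hn.trans (hsimple _)

end PlugIn

/-- Complete the square in `z`. With `w` the squared width, the prefactor is the determinant ratio
and the exponent is the Sherman–Morrison increment, which together make up one step of the
self-normalized process. -/
theorem lintegral_gaussian_exp_quadratic (a c : ℝ) {w : ℝ} (hw : 0 ≤ w) :
    ∫⁻ z, ENNReal.ofReal (Real.exp ((a + √w * z) * c - (a + √w * z) ^ 2 / 2)) ∂gaussianReal 0 1 =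
      ENNReal.ofReal ((√(1 + w))⁻¹ *
        Real.exp ((2 * a * c + w * c ^ 2 - a ^ 2) / (2 * (1 + w)))) := by
  have hw1 : 0 < 1 + w := by positivity
  have hs : √w ^ 2 = w := Real.sq_sqrt hw
  set p : ℝ := √w * (c - a) / (1 + w) with hp
  set K : ℝ := Real.exp ((2 * a * c + w * c ^ 2 - a ^ 2) / (2 * (1 + w))) with hK
  rw [gaussianReal_of_var_ne_zero _ one_ne_zero, lintegral_withDensity_eq_lintegral_mul _
    (measurable_gaussianPDF _ _) (by fun_prop)]
  have hfun : ∀ z, (gaussianPDF 0 1 * fun z => ENNReal.ofReal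
      (Real.exp ((a + √w * z) * c - (a + √w * z) ^ 2 / 2))) z =
      ENNReal.ofReal ((√(2 * Real.pi))⁻¹ * K * Real.exp (-((1 + w) / 2) * (z - p) ^ 2)) := by
    intro z
    rw [Pi.mul_apply, gaussianPDF, ← ENNReal.ofReal_mul (gaussianPDFReal_nonneg _ _ _),
      gaussianPDFReal, hK, mul_assoc (√(2 * Real.pi * _))⁻¹, mul_assoc (√(2 * Real.pi))⁻¹,
      ← Real.exp_add, ← Real.exp_add]
    have hexp : -(z - 0) ^ 2 / (2 * ((1 : NNReal) : ℝ)) +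
        ((a + √w * z) * c - (a + √w * z) ^ 2 / 2) =
        (2 * a * c + w * c ^ 2 - a ^ 2) / (2 * (1 + w)) + -((1 + w) / 2) * (z - p) ^ 2 := by
      have hp2 : (z - p) * (1 + w) = z * (1 + w) - √w * (c - a) := by
        rw [hp]
        field_simp
      have hp3 : (z - p) ^ 2 = (z * (1 + w) - √w * (c - a)) ^ 2 / (1 + w) ^ 2 := by
        rw [← hp2]
        field_simp
      rw [hp3, NNReal.coe_one]
      field_simp
      linear_combination (-(1 + w) * z ^ 2 + (c - a) ^ 2) * hs
    rw [hexp]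
    simp
  rw [lintegral_congr hfun]
  have hint : Integrable fun z : ℝ => Real.exp (-((1 + w) / 2) * (z - p) ^ 2) :=
    (integrable_exp_neg_mul_sq (by positivity : 0 < (1 + w) / 2)).comp_sub_right p
  rw [← ofReal_integral_eq_lintegral_ofReal (hint.const_mul _)
    (ae_of_all _ fun _ => by positivity), integral_const_mul,
    integral_sub_right_eq_self (fun z : ℝ => Real.exp (-((1 + w) / 2) * z ^ 2)) p,
    integral_gaussian]
  congr 1
  rw [show Real.pi / ((1 + w) / 2) = 2 * Real.pi * (1 + w)⁻¹ by field_simp,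
    Real.sqrt_mul (by positivity : 0 ≤ 2 * Real.pi), Real.sqrt_inv]
  have : √(2 * Real.pi) ≠ 0 := by positivity
  field_simp

/-- Ville's maximal inequality on a finite horizon. -/
theorem mul_measure_exists_le_of_lintegral_le {Ω : Type*} [m₀ : MeasurableSpace Ω] {μ : Measure Ω}
    {F : ℕ → MeasurableSpace Ω} (hF : Monotone F) (hFm : ∀ t, F t ≤ m₀) {Q : ℕ → Ω → ℝ≥0∞} {T : ℕ}
    (hQ : ∀ t, 1 ≤ t → Measurable[F t] (Q t)) {C : ℝ≥0∞} (h1 : ∫⁻ ω, Q 1 ω ∂μ ≤ C)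
    (hstep : ∀ t, 1 ≤ t → t < T → ∀ A, MeasurableSet[F t] A →
      ∫⁻ ω in A, Q (t + 1) ω ∂μ ≤ ∫⁻ ω in A, Q t ω ∂μ) (c : ℝ≥0∞) :
    c * μ {ω | ∃ t ∈ Finset.Icc 1 T, c ≤ Q t ω} ≤ C := by
  rcases Nat.eq_zero_or_pos T with rfl | hT
  · simp
  let H : ℕ → Set Ω := fun t => {ω | ∃ k ∈ Finset.Icc 1 t, c ≤ Q k ω}
  have hB : ∀ k, 1 ≤ k → MeasurableSet[F k] {ω | c ≤ Q k ω} := fun k hk => (hQ k hk) measurableSet_Ici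
  have hH : ∀ t, MeasurableSet[F t] (H t) := by
    intro t
    have : H t = ⋃ k ∈ Finset.Icc 1 t, {ω | c ≤ Q k ω} := by ext; simp [H]
    rw [this]
    exact Finset.measurableSet_biUnion _ fun k hk =>
      hF (Finset.mem_Icc.1 hk).2 _ (hB k (Finset.mem_Icc.1 hk).1)
  -- Markov's inequality only on the part of `A` where the level is reached, keeping the integral
  -- over the rest.
  have hmark : ∀ (A : Set Ω) (t : ℕ), 1 ≤ t →
      c * μ ({ω | c ≤ Q t ω} ∩ A) + ∫⁻ ω in A \ {ω | c ≤ Q t ω}, Q t ω ∂μ ≤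
        ∫⁻ ω in A, Q t ω ∂μ := by
    intro A t ht
    have hBm := hFm t _ (hB t ht)
    rw [← lintegral_inter_add_sdiff (Q t) A hBm, Set.inter_comm A]
    gcongr
    rw [← setLIntegral_const]
    refine setLIntegral_mono ((hQ t ht).mono (hFm t) le_rfl) fun ω hω => hω.1
  -- Optional stopping as an invariant: paths stopped by time `t` are charged `c`, the others still
  -- carry `Q t`, and the total never exceeds `C`.
  have key : ∀ t, 1 ≤ t → t ≤ T → c * μ (H t) + ∫⁻ ω in (H t)ᶜ, Q t ω ∂μ ≤ C := by
    intro t ht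
    induction t, ht using Nat.le_induction with
    | base =>
      intro _
      have hH1 : H 1 = {ω | c ≤ Q 1 ω} := by
        ext ω
        simp only [H, Finset.Icc_self, Finset.mem_singleton, exists_eq_left]
      have := (hmark Set.univ 1 le_rfl).trans (by simpa using h1)
      rw [hH1]
      simpa [Set.compl_eq_univ_sdiff] using this
    | succ t ht ih =>
      intro htT
      have hsplit : H (t + 1) = H t ∪ ({ω | c ≤ Q (t + 1) ω} ∩ (H t)ᶜ) := by
        ext ω
        simp only [H, Set.mem_ofPred_eq, Finset.mem_Icc, Set.mem_union, Set.mem_inter_iff,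
          Set.mem_compl_iff]
        constructor
        · rintro ⟨k, hk, hck⟩
          by_cases h : ∃ k, (1 ≤ k ∧ k ≤ t) ∧ c ≤ Q k ω
          · exact Or.inl h
          · refine Or.inr ⟨?_, h⟩
            rcases hk.2.lt_or_eq with hlt | rfl
            · exact absurd ⟨k, ⟨hk.1, Nat.lt_succ_iff.1 hlt⟩, hck⟩ h
            · exact hck
        · rintro (⟨k, hk, hck⟩ | ⟨hck, _⟩)
          · exact ⟨k, ⟨hk.1, hk.2.trans (Nat.le_succ t)⟩, hck⟩
          · exact ⟨t + 1, ⟨by omega, le_rfl⟩, hck⟩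
      have hcompl : (H (t + 1))ᶜ = (H t)ᶜ \ {ω | c ≤ Q (t + 1) ω} := by
        rw [hsplit]
        ext ω
        simp only [Set.mem_compl_iff, Set.mem_union, Set.mem_inter_iff, Set.mem_sdiff]
        tauto
      calc c * μ (H (t + 1)) + ∫⁻ ω in (H (t + 1))ᶜ, Q (t + 1) ω ∂μ
          ≤ c * μ (H t) + (c * μ ({ω | c ≤ Q (t + 1) ω} ∩ (H t)ᶜ)
              + ∫⁻ ω in (H t)ᶜ \ {ω | c ≤ Q (t + 1) ω}, Q (t + 1) ω ∂μ) := by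
            rw [hcompl, ← add_assoc, ← mul_add]
            gcongr
            rw [hsplit]
            exact measure_union_le _ _
        _ ≤ c * μ (H t) + ∫⁻ ω in (H t)ᶜ, Q (t + 1) ω ∂μ := by
            gcongr
            exact hmark _ _ (by omega)
        _ ≤ c * μ (H t) + ∫⁻ ω in (H t)ᶜ, Q t ω ∂μ := by
            gcongr 1
            exact hstep t ht (by omega) _ (hH t).compl
        _ ≤ C := ih (by omega)
  exact le_self_add.trans (key T hT le_rfl)

/-! ### Measurability of the regression quantities. -/

section Measurability

variable {Ω : Type*} {m : MeasurableSpace Ω} {d : ℕ}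

theorem measurable_det_of_entries {M : Ω → Matrix (Fin d) (Fin d) ℝ}
    (hM : ∀ i j, Measurable fun ω => M ω i j) : Measurable fun ω => (M ω).det := by
  simp only [Matrix.det_apply']
  fun_prop

/-- By the adjugate formula each entry is a product of a determinant and an inverted determinant. -/
theorem measurable_inv_apply {M : Ω → Matrix (Fin d) (Fin d) ℝ}
    (hM : ∀ i j, Measurable fun ω => M ω i j) (i j : Fin d) :
    Measurable fun ω => (M ω)⁻¹ i j := by
  simp only [Matrix.inv_def, Ring.inverse_eq_inv', Matrix.smul_apply, smul_eq_mul,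
    Matrix.adjugate_apply]
  refine (measurable_det_of_entries hM).inv.mul (measurable_det_of_entries fun k l => ?_)
  by_cases h : k = j
  · subst h
    simp
  · simpa [Matrix.updateRow_ne h] using hM k l

variable {lam : ℝ} {x : ℕ → Ω → EuclideanSpace ℝ (Fin d)} {t : ℕ}

theorem measurable_designMatrix_apply (hx : ∀ k ∈ Finset.Ico 1 t, Measurable[m] (x k))
    (i j : Fin d) : Measurable fun ω => designMatrix lam (fun k => x k ω) t i j := by
  simp only [designMatrix, Matrix.add_apply, Matrix.sum_apply, Matrix.vecMulVec_apply]
  refine (Finset.measurable_fun_sum _ fun k hk => ?_).add measurable_const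
  have := hx k hk
  fun_prop

theorem measurable_dotProduct_inv_designMatrix
    (hx : ∀ k ∈ Finset.Ico 1 t, Measurable[m] (x k)) {u v : Ω → EuclideanSpace ℝ (Fin d)}
    (hu : Measurable u) (hv : Measurable v) :
    Measurable fun ω =>
      (u ω).ofLp ⬝ᵥ ((designMatrix lam (fun k => x k ω) t)⁻¹ *ᵥ (v ω).ofLp) := by
  simp only [dotProduct, Matrix.mulVec]
  have hu' : ∀ i, Measurable fun ω => (u ω).ofLp i := fun i => by fun_prop
  have hv' : ∀ i, Measurable fun ω => (v ω).ofLp i := fun i => by fun_prop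
  exact Finset.measurable_fun_sum _ fun i _ => (hu' i).mul <|
    Finset.measurable_fun_sum _ fun j _ =>
      (measurable_inv_apply (measurable_designMatrix_apply hx) i j).mul (hv' j)

end Measurability

/-! ### The self-normalized exponential process. -/

/-- The noise part `∑_{k=1}^{t-1} ξ_k x_k` of the regression target. -/
noncomputable def noiseSum {d : ℕ} (x : ℕ → EuclideanSpace ℝ (Fin d)) (ξ : ℕ → ℝ) (t : ℕ) :
    EuclideanSpace ℝ (Fin d) :=
  ∑ k ∈ Finset.Ico 1 t, ξ k • x k

theorem noiseSum_succ {d : ℕ} (x : ℕ → EuclideanSpace ℝ (Fin d)) (ξ : ℕ → ℝ) {t : ℕ}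
    (ht : 1 ≤ t) : noiseSum x ξ (t + 1) = noiseSum x ξ t + ξ t • x t :=
  Finset.sum_Ico_succ_top ht _

/-- The self-normalized exponential process
`exp (‖∑ ξ_k x_k‖²_{V_t⁻¹} / (2 σ²)) / √(det V_t / lam ^ d)`. -/
noncomputable def selfNormalizedExp {d : ℕ} (lam σ : ℝ) (x : ℕ → EuclideanSpace ℝ (Fin d))
    (ξ : ℕ → ℝ) (t : ℕ) : ℝ :=
  Real.exp (width lam x t (noiseSum x ξ t) ^ 2 / (2 * σ ^ 2)) *
    (√((designMatrix lam x t).det / lam ^ d))⁻¹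

theorem selfNormalizedExp_one {d : ℕ} {lam : ℝ} (hlam : 0 < lam) (σ : ℝ)
    (x : ℕ → EuclideanSpace ℝ (Fin d)) (ξ : ℕ → ℝ) : selfNormalizedExp lam σ x ξ 1 = 1 := by
  have : lam ^ d ≠ 0 := by positivity
  simp [selfNormalizedExp, det_designMatrix_one, noiseSum, width, weightedNorm, this]

/-- The one-step ratio of the self-normalized process is a Gaussian mixture of exponentials. -/
theorem ofReal_selfNormalizedExp_succ {d : ℕ} {lam σ : ℝ} (hlam : 0 < lam) (hσ : 0 < σ)
    (x : ℕ → EuclideanSpace ℝ (Fin d)) (ξ : ℕ → ℝ) {t : ℕ} (ht : 1 ≤ t) :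
    ENNReal.ofReal (selfNormalizedExp lam σ x ξ (t + 1)) =
      ∫⁻ z, ENNReal.ofReal (selfNormalizedExp lam σ x ξ t) * ENNReal.ofReal (Real.exp
        (((x t).ofLp ⬝ᵥ ((designMatrix lam x t)⁻¹ *ᵥ (noiseSum x ξ t).ofLp) / σ
            + width lam x t (x t) * z) / σ * ξ t
          - (((x t).ofLp ⬝ᵥ ((designMatrix lam x t)⁻¹ *ᵥ (noiseSum x ξ t).ofLp) / σ
            + width lam x t (x t) * z) / σ) ^ 2 * σ ^ 2 / 2)) ∂gaussianReal 0 1 := by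
  have hV := designMatrix_posDef x hlam t
  set a := (x t).ofLp ⬝ᵥ ((designMatrix lam x t)⁻¹ *ᵥ (noiseSum x ξ t).ofLp) with ha
  set w := width lam x t (x t) ^ 2 with hw
  have hw0 : 0 ≤ w := sq_nonneg _
  have hsw : width lam x t (x t) = √w := (Real.sqrt_sq (width_nonneg x t _)).symm
  rw [lintegral_const_mul _ (by fun_prop)]
  -- In the method of mixtures with prior `N(0, λ⁻¹I)` on a direction `h`, the posterior is
  -- `N(V_t⁻¹s_t/σ, V_t⁻¹)`. Under it `⟨x_t, h⟩` is distributed as `a/σ + √w z`, which explains the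
  -- exponent; here the powers of `σ` cancel.
  have hfun : ∀ z, (a / σ + width lam x t (x t) * z) / σ * ξ t
      - ((a / σ + width lam x t (x t) * z) / σ) ^ 2 * σ ^ 2 / 2 =
      (a / σ + √w * z) * (ξ t / σ) - (a / σ + √w * z) ^ 2 / 2 := by
    intro z
    rw [hsw]
    field_simp
  simp only [hfun]
  rw [lintegral_gaussian_exp_quadratic _ _ hw0, ← ENNReal.ofReal_mul (by
    unfold selfNormalizedExp; positivity)]
  congr 1
  have hquad : width lam x (t + 1) (noiseSum x ξ (t + 1)) ^ 2 =
      width lam x t (noiseSum x ξ t) ^ 2 + (2 * a * ξ t + w * ξ t ^ 2 - a ^ 2) / (1 + w) := by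
    rw [width_sq x hlam, width_sq x hlam, noiseSum_succ x ξ ht, designMatrix_succ x ht, hw,
      width_sq x hlam, WithLp.ofLp_add, WithLp.ofLp_smul, quadForm_inv_add_vecMulVec hV]
  rw [selfNormalizedExp, selfNormalizedExp, det_designMatrix_succ x hlam ht, hquad, add_div,
    Real.exp_add, ← hw, mul_div_right_comm, Real.sqrt_mul (by have := hV.det_pos; positivity),
    mul_inv]
  have : (2 * a * ξ t + w * ξ t ^ 2 - a ^ 2) / (1 + w) / (2 * σ ^ 2) =
      (2 * (a / σ) * (ξ t / σ) + w * (ξ t / σ) ^ 2 - (a / σ) ^ 2) / (2 * (1 + w)) := by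
    field_simp
  rw [this]
  ring

/-! ### Uniform self-normalized noise bounds. -/

section NoiseBounds

variable {Ω : Type*} [m₀ : MeasurableSpace Ω] {μ : Measure Ω} {d T : ℕ} {lam : ℝ}
  {x : ℕ → Ω → EuclideanSpace ℝ (Fin d)} {ξ : ℕ → Ω → ℝ}

theorem history_le (hx : ∀ t, Measurable (x t)) (hξ : ∀ t, Measurable (ξ t)) (t : ℕ) :
    history x ξ t ≤ m₀ :=
  sup_le (iSup₂_le fun k _ => (hx k).comap_le) (iSup₂_le fun k _ => (hξ k).comap_le)

omit m₀ in
theorem history_mono : Monotone (history x ξ) := fun _ _ hst =>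
  sup_le_sup (biSup_mono fun _ hk => Finset.Icc_subset_Icc_right hst hk)
    (biSup_mono fun _ hk => Finset.Ico_subset_Ico_right hst hk)

omit m₀ in
theorem measurable_action_history {t k : ℕ} (hk : k ∈ Finset.Icc 1 t) :
    Measurable[history x ξ t] (x k) :=
  measurable_iff_comap_le.2 ((le_iSup₂ (f := fun k (_ : k ∈ Finset.Icc 1 t) =>
    MeasurableSpace.comap (x k) inferInstance) k hk).trans le_sup_left)

omit m₀ in
theorem measurable_noise_history {t k : ℕ} (hk : k ∈ Finset.Ico 1 t) :
    Measurable[history x ξ t] (ξ k) :=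
  measurable_iff_comap_le.2 ((le_iSup₂ (f := fun k (_ : k ∈ Finset.Ico 1 t) =>
    MeasurableSpace.comap (ξ k) inferInstance) k hk).trans le_sup_right)

omit m₀ in
theorem measurable_action_history_of_Ico {t k : ℕ} (hk : k ∈ Finset.Ico 1 t) :
    Measurable[history x ξ t] (x k) :=
  measurable_action_history (Finset.Ico_subset_Icc_self hk)

omit m₀ in
theorem measurable_noiseSum (t : ℕ) :
    Measurable[history x ξ t] fun ω => noiseSum (fun k => x k ω) (fun k => ξ k ω) t := by
  unfold noiseSum
  exact Finset.measurable_fun_sum _ fun k hk =>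
    (measurable_noise_history hk).smul (measurable_action_history_of_Ico hk)

omit m₀ in
theorem measurable_width {t : ℕ} {u : Ω → EuclideanSpace ℝ (Fin d)}
    (hu : Measurable[history x ξ t] u) :
    Measurable[history x ξ t] fun ω => width lam (fun k => x k ω) t (u ω) :=
  (measurable_dotProduct_inv_designMatrix
    (fun _ hk => measurable_action_history_of_Ico hk) hu hu).sqrt

omit m₀ in
theorem measurable_selfNormalizedExp (σ : ℝ) (t : ℕ) :
    Measurable[history x ξ t] fun ω =>
      selfNormalizedExp lam σ (fun k => x k ω) (fun k => ξ k ω) t := by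
  unfold selfNormalizedExp
  have h1 : Measurable[history x ξ t] fun ω => width lam (fun k => x k ω) t
    (noiseSum (fun k => x k ω) (fun k => ξ k ω) t) := measurable_width (measurable_noiseSum t)
  have h2 : Measurable[history x ξ t] fun ω => (designMatrix lam (fun k => x k ω) t).det :=
    measurable_det_of_entries
      (measurable_designMatrix_apply fun _ hk => measurable_action_history_of_Ico hk)
  fun_prop

/-- The supermartingale step. Tonelli moves the Gaussian variable `z` outside; for each fixed `z`
the exponent is measurable in the history, so `lintegral_mul_exp_le` removes its factor. -/
theorem setLIntegral_selfNormalizedExp_succ_le [IsFiniteMeasure μ] (hlam : 0 < lam)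
    (hx : ∀ t, Measurable (x t)) (hξ : ∀ t, Measurable (ξ t)) {σ : ℝ} (hσ : 0 < σ) {t : ℕ}
    (ht : 1 ≤ t)
    (hsub : ∀ s : ℝ, Integrable (fun ω => Real.exp (s * ξ t ω)) μ ∧
      μ[fun ω => Real.exp (s * ξ t ω) | history x ξ t]
        ≤ᵐ[μ] fun _ => Real.exp (s ^ 2 * σ ^ 2 / 2))
    {A : Set Ω} (hA : MeasurableSet[history x ξ t] A) :
    ∫⁻ ω in A, ENNReal.ofReal
        (selfNormalizedExp lam σ (fun k => x k ω) (fun k => ξ k ω) (t + 1)) ∂μ ≤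
      ∫⁻ ω in A, ENNReal.ofReal
        (selfNormalizedExp lam σ (fun k => x k ω) (fun k => ξ k ω) t) ∂μ := by
  have hm := history_le hx hξ t
  let Q : Ω → ℝ≥0∞ := fun ω => ENNReal.ofReal
    (selfNormalizedExp lam σ (fun k => x k ω) (fun k => ξ k ω) t)
  let a : Ω → ℝ := fun ω => (x t ω).ofLp ⬝ᵥ ((designMatrix lam (fun k => x k ω) t)⁻¹ *ᵥ
    (noiseSum (fun k => x k ω) (fun k => ξ k ω) t).ofLp)
  let w : Ω → ℝ := fun ω => width lam (fun k => x k ω) t (x t ω)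
  have hxt : Measurable[history x ξ t] (x t) :=
    measurable_action_history (Finset.mem_Icc.2 ⟨ht, le_rfl⟩)
  have hQ : Measurable[history x ξ t] Q := (measurable_selfNormalizedExp σ t).ennreal_ofReal
  have ha : Measurable[history x ξ t] a := measurable_dotProduct_inv_designMatrix
    (fun _ hk => measurable_action_history_of_Ico hk) hxt (measurable_noiseSum t)
  have hw : Measurable[history x ξ t] w := measurable_width hxt
  let E : Ω → ℝ → ℝ≥0∞ := fun ω z => ENNReal.ofReal (Real.exp
    ((a ω / σ + w ω * z) / σ * ξ t ω - ((a ω / σ + w ω * z) / σ) ^ 2 * σ ^ 2 / 2))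
  have hE : Measurable (Function.uncurry E) := by
    have h1 : Measurable a := ha.mono hm le_rfl
    have h2 : Measurable w := hw.mono hm le_rfl
    have h3 := hξ t
    have h1' : Measurable fun p : Ω × ℝ => a p.1 := h1.comp measurable_fst
    have h2' : Measurable fun p : Ω × ℝ => w p.1 := h2.comp measurable_fst
    have h3' : Measurable fun p : Ω × ℝ => ξ t p.1 := h3.comp measurable_fst
    exact Measurable.ennreal_ofReal (by fun_prop)
  have hQA : Measurable[history x ξ t] (A.indicator Q) := hQ.indicator hA
  have hQA' : Measurable (A.indicator Q) := hQA.mono hm le_rfl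
  rw [← lintegral_indicator (hm A hA), ← lintegral_indicator (hm A hA)]
  calc ∫⁻ ω, A.indicator (fun ω => ENNReal.ofReal
        (selfNormalizedExp lam σ (fun k => x k ω) (fun k => ξ k ω) (t + 1))) ω ∂μ
      = ∫⁻ ω, ∫⁻ z, A.indicator Q ω * E ω z ∂gaussianReal 0 1 ∂μ := by
        refine lintegral_congr fun ω => ?_
        by_cases h : ω ∈ A
        · simp only [Set.indicator_of_mem h]
          exact ofReal_selfNormalizedExp_succ hlam hσ _ _ ht
        · simp [Set.indicator_of_notMem h]
    _ = ∫⁻ z, ∫⁻ ω, A.indicator Q ω * E ω z ∂μ ∂gaussianReal 0 1 :=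
        lintegral_lintegral_swap ((hQA'.comp measurable_fst).mul hE).aemeasurable
    _ ≤ ∫⁻ _, ∫⁻ ω, A.indicator Q ω ∂μ ∂gaussianReal 0 1 := by
        refine lintegral_mono fun z => lintegral_mul_exp_le hm (hξ t) hsub ?_ hQA
        exact ((ha.div_const σ).add (hw.mul_const z)).div_const σ
    _ = ∫⁻ ω, A.indicator Q ω ∂μ := by simp

theorem measure_exists_selfNormalizedExp_ge_le [IsProbabilityMeasure μ] (hlam : 0 < lam)
    (hx : ∀ t, Measurable (x t)) (hξ : ∀ t, Measurable (ξ t)) {σ : ℝ} (hσ : 0 < σ)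
    (hnoise : IsSubgaussianNoise μ T x σ ξ) {δ : ℝ} (hδ : 0 < δ) :
    μ {ω | ∃ t ∈ Finset.Icc 1 T,
      1 / δ ≤ selfNormalizedExp lam σ (fun k => x k ω) (fun k => ξ k ω) t} ≤
      ENNReal.ofReal δ := by
  have h := mul_measure_exists_le_of_lintegral_le (μ := μ) (T := T) (C := 1)
    (Q := fun t ω => ENNReal.ofReal
      (selfNormalizedExp lam σ (fun k => x k ω) (fun k => ξ k ω) t))
    (history_mono (x := x) (ξ := ξ)) (history_le hx hξ)
    (fun t _ => (measurable_selfNormalizedExp σ t).ennreal_ofReal)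
    (by simp [selfNormalizedExp_one hlam])
    (fun t ht htT A hA => setLIntegral_selfNormalizedExp_succ_le hlam hx hξ hσ ht
      (hnoise t (Finset.mem_Icc.2 ⟨ht, htT.le⟩)).2 hA) (ENNReal.ofReal (1 / δ))
  have hset : {ω | ∃ t ∈ Finset.Icc 1 T,
      1 / δ ≤ selfNormalizedExp lam σ (fun k => x k ω) (fun k => ξ k ω) t} =
      {ω | ∃ t ∈ Finset.Icc 1 T, ENNReal.ofReal (1 / δ) ≤
        ENNReal.ofReal (selfNormalizedExp lam σ (fun k => x k ω) (fun k => ξ k ω) t)} := by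
    ext ω
    have hnn : ∀ t, 0 ≤ selfNormalizedExp lam σ (fun k => x k ω) (fun k => ξ k ω) t := fun t => by
      unfold selfNormalizedExp; positivity
    simp only [Set.mem_ofPred_eq, ENNReal.ofReal_le_ofReal_iff (hnn _)]
  rw [hset]
  calc _ = ENNReal.ofReal δ * (ENNReal.ofReal (1 / δ) * μ {ω | ∃ t ∈ Finset.Icc 1 T,
        ENNReal.ofReal (1 / δ) ≤
        ENNReal.ofReal (selfNormalizedExp lam σ (fun k => x k ω) (fun k => ξ k ω) t)}) := by
        rw [← mul_assoc, ← ENNReal.ofReal_mul hδ.le, mul_one_div_cancel hδ.ne']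
        simp
    _ ≤ _ := by
        simpa using mul_le_mul_right h (ENNReal.ofReal δ)

/-- The logarithmic factor of the confidence radius. -/
noncomputable def confLog (d : ℕ) (lam δ : ℝ) (t : ℕ) : ℝ :=
  √((d : ℝ) * Real.log ((1 + ((t : ℝ) - 1) / lam) / δ))

/-- Taking logarithms bounds the squared width by `σ²(log(det V_t / λ^d) + 2 log(1/δ))`. Since `d ≥
2` and `δ ≤ 1`, the term `2 log(1/δ)` is at most `d log(1/δ)`, which yields the single factor `d` in
the radius. -/
theorem width_noiseSum_le_of_selfNormalizedExp_lt {x : ℕ → EuclideanSpace ℝ (Fin d)} {ξ : ℕ → ℝ}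
    {σ δ : ℝ} {t : ℕ} (hd : 2 ≤ d) (hlam : 0 < lam) (hσ : 0 < σ) (hδ : 0 < δ) (hδ₁ : δ ≤ 1)
    (ht : 1 ≤ t) (hx : ∀ k ∈ Finset.Ico 1 t, ‖x k‖ ≤ 1)
    (h : selfNormalizedExp lam σ x ξ t < 1 / δ) :
    width lam x t (noiseSum x ξ t) ≤ σ * confLog d lam δ t := by
  have hd2 : (2 : ℝ) ≤ d := by exact_mod_cast hd
  have ht1 : (0 : ℝ) ≤ (t : ℝ) - 1 := by
    have : (1 : ℝ) ≤ t := by exact_mod_cast ht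
    linarith
  have hdet := (designMatrix_posDef x hlam t).det_pos
  set W := width lam x t (noiseSum x ξ t) with hW
  set D := (designMatrix lam x t).det / lam ^ d with hD
  have hD0 : 0 < D := by positivity
  have hlt : W ^ 2 / (2 * σ ^ 2) < Real.log (√D / δ) := by
    rw [Real.lt_log_iff_exp_lt (by positivity)]
    rw [selfNormalizedExp, ← div_eq_mul_inv, div_lt_iff₀ (by positivity)] at h
    rwa [one_div_mul_eq_div] at h
  have hDle : D ≤ (1 + ((t : ℝ) - 1) / lam) ^ d := by
    have h1 := det_designMatrix_le x hlam (by omega) ht hx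
    rw [mul_pow] at h1
    calc D ≤ (1 + ((t : ℝ) - 1) / (lam * d)) ^ d := by
          rw [hD, div_le_iff₀ (by positivity), mul_comm]
          exact h1
      _ ≤ _ := by
          gcongr
          nlinarith
  have hlogD : Real.log D ≤ d * Real.log (1 + ((t : ℝ) - 1) / lam) := by
    rw [← Real.log_pow]
    exact Real.log_le_log hD0 hDle
  have hlogδ : Real.log δ ≤ 0 := Real.log_nonpos hδ.le hδ₁
  rw [Real.log_div (by positivity) hδ.ne', Real.log_sqrt hD0.le, div_lt_iff₀ (by positivity)] at hlt
  rw [confLog, Real.log_div (by positivity) hδ.ne']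
  rw [← Real.sqrt_sq hσ.le, ← Real.sqrt_mul (sq_nonneg σ)]
  refine Real.le_sqrt_of_sq_le (hlt.le.trans ?_)
  have hσ2 : 0 < σ ^ 2 := by positivity
  have : (Real.log D / 2 - Real.log δ) * 2 ≤
      d * (Real.log (1 + ((t : ℝ) - 1) / lam) - Real.log δ) := by nlinarith
  nlinarith

theorem IsSubgaussianNoise.mono {ρ σ : ℝ} (hρ : 0 ≤ ρ) (hρσ : ρ ≤ σ)
    (h : IsSubgaussianNoise μ T x ρ ξ) : IsSubgaussianNoise μ T x σ ξ := by
  intro t ht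
  refine ⟨(h t ht).1, fun s => ⟨((h t ht).2 s).1, ((h t ht).2 s).2.trans (ae_of_all _ fun _ => ?_)⟩⟩
  exact Real.exp_le_exp.2 (by gcongr)

/-- The self-normalized concentration inequality, uniformly over the rounds `1, …, T`. -/
theorem measure_exists_width_noiseSum_gt_le [IsProbabilityMeasure μ] (hd : 2 ≤ d) (hlam : 0 < lam)
    (hx : ∀ t, Measurable (x t)) (hξ : ∀ t, Measurable (ξ t))
    (hxb : ∀ ω, ∀ t ∈ Finset.Icc 1 T, ‖x t ω‖ ≤ 1) {ρ : ℝ} (hρ : 0 ≤ ρ)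
    (hnoise : IsSubgaussianNoise μ T x ρ ξ) {δ : ℝ} (hδ : 0 < δ) (hδ₁ : δ ≤ 1) :
    μ {ω | ∃ t ∈ Finset.Icc 1 T, ρ * confLog d lam δ t <
      width lam (fun k => x k ω) t (noiseSum (fun k => x k ω) (fun k => ξ k ω) t)} ≤
      ENNReal.ofReal δ := by
  let B : ℝ → Set Ω := fun σ => {ω | ∃ t ∈ Finset.Icc 1 T, σ * confLog d lam δ t <
      width lam (fun k => x k ω) t (noiseSum (fun k => x k ω) (fun k => ξ k ω) t)}
  -- The exponential process divides by `σ`, while `ρ = 0` is allowed. So the bound is proved for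
  -- every `σ > ρ`; because the inequality defining `B` is strict, `B ρ` is covered by the
  -- increasing union of `B σ` as `σ` decreases to `ρ`.
  have hBσ : ∀ σ, ρ < σ → μ (B σ) ≤ ENNReal.ofReal δ := by
    intro σ hσ
    have hσ0 : 0 < σ := hρ.trans_lt hσ
    refine (measure_mono ?_).trans (measure_exists_selfNormalizedExp_ge_le hlam hx hξ hσ0
      (hnoise.mono hρ hσ.le) hδ)
    rintro ω ⟨t, ht, hlt⟩
    refine ⟨t, ht, ?_⟩
    by_contra! hcon
    have ht' := Finset.mem_Icc.1 ht
    refine hlt.not_ge (width_noiseSum_le_of_selfNormalizedExp_lt hd hlam hσ0 hδ hδ₁ ht'.1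
      (fun k hk => hxb ω k ?_) hcon)
    have := Finset.mem_Ico.1 hk
    exact Finset.mem_Icc.2 ⟨this.1, by omega⟩
  have hmono : Monotone fun n : ℕ => B (ρ + 1 / ((n : ℝ) + 1)) := by
    rintro n k hnk ω ⟨t, ht, hlt⟩
    refine ⟨t, ht, lt_of_le_of_lt ?_ hlt⟩
    have : 0 ≤ confLog d lam δ t := Real.sqrt_nonneg _
    gcongr
  have hunion : B ρ ⊆ ⋃ n : ℕ, B (ρ + 1 / ((n : ℝ) + 1)) := by
    rintro ω ⟨t, ht, hlt⟩
    have hlim : Tendsto (fun n : ℕ => (ρ + 1 / ((n : ℝ) + 1)) * confLog d lam δ t) atTop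
        (𝓝 (ρ * confLog d lam δ t)) := by
      simpa using (tendsto_one_div_add_atTop_nhds_zero_nat.const_add ρ).mul_const
        (confLog d lam δ t)
    obtain ⟨n, hn⟩ := (hlim.eventually_lt_const hlt).exists
    exact Set.mem_iUnion.2 ⟨n, t, ht, hn⟩
  calc μ (B ρ) ≤ μ (⋃ n : ℕ, B (ρ + 1 / ((n : ℝ) + 1))) := measure_mono hunion
    _ = ⨆ n : ℕ, μ (B (ρ + 1 / ((n : ℝ) + 1))) := hmono.measure_iUnion
    _ ≤ ENNReal.ofReal δ := iSup_le fun n => hBσ _ (by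
        have : 0 < 1 / ((n : ℝ) + 1) := by positivity
        linarith)

end NoiseBounds

/-! ### Estimation error, optimism and pessimistic feasibility on the good event. -/

section Deterministic

variable {d : ℕ} {lam : ℝ} (x : ℕ → EuclideanSpace ℝ (Fin d))

theorem inner_eq_dotProduct (u v : EuclideanSpace ℝ (Fin d)) :
    inner ℝ u v = v.ofLp ⬝ᵥ u.ofLp := by
  rw [EuclideanSpace.inner_eq_star_dotProduct, star_trivial]

/-- Since `∑ x_k x_kᵀ = V_t - λI`, the estimation error splits into a noise term and the
regularization bias `-λ V_t⁻¹θ`. -/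
theorem sum_scalarObs_smul (θ : EuclideanSpace ℝ (Fin d)) (ε : ℕ → ℝ) (t : ℕ) :
    ∑ k ∈ Finset.Ico 1 t, scalarObs θ x ε k • (x k).ofLp =
      designMatrix lam x t *ᵥ θ.ofLp + ((noiseSum x ε t).ofLp - lam • θ.ofLp) := by
  simp only [scalarObs, noiseSum, designMatrix, Matrix.add_mulVec, Matrix.smul_mulVec,
    Matrix.one_mulVec, Matrix.sum_mulVec, Matrix.vecMulVec_mulVec, add_smul,
    Finset.sum_add_distrib, WithLp.ofLp_sum, WithLp.ofLp_smul, inner_eq_dotProduct]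
  simp only [op_smul_eq_smul]
  abel

theorem inner_ridgeEstimator_scalarObs (hlam : 0 < lam) (θ u : EuclideanSpace ℝ (Fin d))
    (ε : ℕ → ℝ) (t : ℕ) :
    inner ℝ (ridgeEstimator lam x (scalarObs θ x ε) t) u = inner ℝ θ u +
      (u.ofLp ⬝ᵥ ((designMatrix lam x t)⁻¹ *ᵥ (noiseSum x ε t).ofLp)
        - lam * (u.ofLp ⬝ᵥ ((designMatrix lam x t)⁻¹ *ᵥ θ.ofLp))) := by
  rw [inner_eq_dotProduct, inner_eq_dotProduct, ridgeEstimator, sum_scalarObs_smul (lam := lam),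
    Matrix.mulVec_add, Matrix.mulVec_mulVec, Matrix.nonsing_inv_mul _
      (isUnit_iff_ne_zero.2 (designMatrix_posDef x hlam t).det_pos.ne'), Matrix.one_mulVec,
    Matrix.mulVec_sub, Matrix.mulVec_smul, dotProduct_add, dotProduct_sub, dotProduct_smul,
    smul_eq_mul]

/-- The ridge estimator is accurate when the noise is small in the self-normalized sense. -/
theorem abs_inner_ridgeEstimator_sub_le (hlam : 0 < lam) {θ : EuclideanSpace ℝ (Fin d)} {ε : ℕ → ℝ}
    {t : ℕ} {N S : ℝ} (hN : width lam x t (noiseSum x ε t) ≤ N) (hS : ‖θ‖ ≤ S)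
    (u : EuclideanSpace ℝ (Fin d)) :
    |inner ℝ (ridgeEstimator lam x (scalarObs θ x ε) t) u - inner ℝ θ u| ≤
      (N + √lam * S) * width lam x t u := by
  have hV := designMatrix_posDef x hlam t
  rw [inner_ridgeEstimator_scalarObs x hlam, add_sub_cancel_left]
  refine (abs_sub _ _).trans ?_
  have h1 := abs_dotProduct_inv_mulVec_le hV u.ofLp (noiseSum x ε t).ofLp
  have h2 := abs_dotProduct_inv_mulVec_le hV u.ofLp θ.ofLp
  change _ ≤ width lam x t u * width lam x t (noiseSum x ε t) at h1
  change _ ≤ width lam x t u * width lam x t θ at h2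
  have hw := width_nonneg (lam := lam) x t u
  -- Of the factor `λ = √λ·√λ` in the bias, one root turns the width of `θ` into `‖θ‖`; the other
  -- remains in the radius.
  have h3 := sqrt_lam_mul_width_le x hlam t θ
  have hl : √lam * √lam = lam := Real.mul_self_sqrt hlam.le
  rw [abs_mul, abs_of_pos hlam]
  calc _ ≤ width lam x t u * N + lam * (width lam x t u * width lam x t θ) := by
        gcongr
        exact h1.trans (by gcongr)
    _ = width lam x t u * (N + √lam * (√lam * width lam x t θ)) := by
        linear_combination (-width lam x t u * width lam x t θ) * hl
    _ ≤ width lam x t u * (N + √lam * S) := by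
        gcongr
        exact h3.trans hS
    _ = _ := mul_comm _ _

theorem confRadius_eq (d n : ℕ) (ρ lam δ S : ℝ) (t : ℕ) :
    confRadius d n ρ lam δ S t = ρ * confLog d lam (δ / ((n : ℝ) + 1)) t + √lam * S := rfl

theorem confRadius_nonneg {n : ℕ} {ρ δ S : ℝ} (hρ : 0 ≤ ρ) (hS : 0 ≤ S) (t : ℕ) :
    0 ≤ confRadius d n ρ lam δ S t := by
  unfold confRadius
  positivity

theorem confRadius_mono {n : ℕ} {ρ δ S : ℝ} (hρ : 0 ≤ ρ) (hlam : 0 < lam) (hδ : 0 < δ)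
    {s t : ℕ} (hs : 1 ≤ s) (hst : s ≤ t) :
    confRadius d n ρ lam δ S s ≤ confRadius d n ρ lam δ S t := by
  have h1 : (0 : ℝ) ≤ (s : ℝ) - 1 := by
    have : (1 : ℝ) ≤ s := by exact_mod_cast hs
    linarith
  unfold confRadius
  gcongr

/-- One round of the optimism argument: the regret of a round is at most a multiple of the width
of the action played. -/
theorem inner_sub_le_of_isMaxOn {θ θhat xstar xt : EuclideanSpace ℝ (Fin d)}
    {t : ℕ} {b q κ Sθ : ℝ} {P : Set (EuclideanSpace ℝ (Fin d))} (hb : 0 ≤ b) (hq : 0 ≤ q)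
    (hκ : κ = 1 + 2 * q * Sθ) (hval : inner ℝ θ xstar ≤ Sθ)
    (hconf : ∀ u, |inner ℝ θhat u - inner ℝ θ u| ≤ b * width lam x t u)
    (hP : (1 + 2 * q * (b * width lam x t xstar))⁻¹ • xstar ∈ P)
    (hmax : IsMaxOn (fun u => inner ℝ θhat u + κ * b * width lam x t u) P xt) :
    inner ℝ θ (xstar - xt) ≤ (1 + κ) * (b * width lam x t xt) := by
  have hw := width_nonneg (lam := lam) x t xstar
  set α := (1 + 2 * q * (b * width lam x t xstar))⁻¹ with hα
  have hα0 : 0 < α := by positivity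
  have hα1 : α * (1 + 2 * q * (b * width lam x t xstar)) = 1 :=
    inv_mul_cancel₀ (by positivity)
  have h1 : inner ℝ θhat (α • xstar) + κ * b * width lam x t (α • xstar) ≤
      inner ℝ θhat xt + κ * b * width lam x t xt := hmax hP
  rw [inner_smul_right, width_smul x t hα0.le] at h1
  have h2 := (abs_le.1 (hconf xstar)).1
  have h3 := (abs_le.1 (hconf xt)).2
  rw [inner_sub_right]
  -- Optimism. Expand `θᵀx_* = α(1 + 2qbw)θᵀx_*` with `w` the width of `x_*`. Bounding `θᵀx_*` by
  -- `Sθ` in the second term and by `θ̂ᵀx_* + bw` in the first leaves exactly the bonus `κbαw`.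
  have h4 : inner ℝ θ xstar ≤
      α * inner ℝ θhat xstar + κ * b * (α * width lam x t xstar) := by
    have h5 : 0 ≤ α * (q * (b * width lam x t xstar)) * (Sθ - inner ℝ θ xstar) :=
      mul_nonneg (by positivity) (sub_nonneg.2 hval)
    have h6 : 0 ≤ α * (inner ℝ θhat xstar - inner ℝ θ xstar + b * width lam x t xstar) :=
      mul_nonneg hα0.le (by linarith)
    have h7 : inner ℝ θ xstar = inner ℝ θ xstar *
        (α * (1 + 2 * q * (b * width lam x t xstar))) := by rw [hα1, mul_one]
    rw [hκ]
    nlinarith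
  linarith

/-- Summing the per-round regret with the elliptical potential bound. -/
theorem regret_le_of_round_le (hlam : 1 ≤ lam) (hd : d ≠ 0) {T : ℕ}
    {θ xstar : EuclideanSpace ℝ (Fin d)} {β : ℕ → ℝ} {K : ℝ} (hK : 0 ≤ K)
    (hβ : ∀ t ∈ Finset.Icc 1 T, β t ≤ β T) (hβT : 0 ≤ β T)
    (hx : ∀ k ∈ Finset.Icc 1 T, ‖x k‖ ≤ 1)
    (hround : ∀ t ∈ Finset.Icc 1 T,
      inner ℝ θ (xstar - x t) ≤ K * (β t * width lam x t (x t))) :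
    regret T θ xstar x ≤ K * β T * √(2 * d * T * Real.log (1 + T / (lam * d))) := by
  calc regret T θ xstar x
      ≤ ∑ t ∈ Finset.Icc 1 T, K * (β T * width lam x t (x t)) := by
        refine Finset.sum_le_sum fun t ht => (hround t ht).trans ?_
        have := width_nonneg (lam := lam) x t (x t)
        have := hβ t ht
        gcongr
    _ = K * β T * ∑ t ∈ Finset.Icc 1 T, width lam x t (x t) := by
        rw [Finset.mul_sum]
        exact Finset.sum_congr rfl fun t _ => by ring
    _ ≤ _ := by
        gcongr
        refine Real.le_sqrt_of_sq_le ?_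
        have h1 := sq_sum_le_card_mul_sum_sq (s := Finset.Icc 1 T)
          (f := fun t => width lam x t (x t))
        have h2 := sum_width_sq_le x hlam hd hx
        rw [Nat.card_Icc, Nat.add_sub_cancel] at h1
        calc _ ≤ _ := h1
          _ ≤ (T : ℝ) * (2 * d * Real.log (1 + T / (lam * d))) := by gcongr
          _ = _ := by ring

theorem norm_le_sqrt_mul_of_abs_le {n : ℕ} {c : ℝ} (hc : 0 ≤ c) {e : EuclideanSpace ℝ (Fin n)}
    (he : ∀ i, |e i| ≤ c) : ‖e‖ ≤ √n * c := by
  rw [EuclideanSpace.norm_eq, ← Real.sqrt_sq hc, ← Real.sqrt_mul n.cast_nonneg]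
  refine Real.sqrt_le_sqrt ?_
  calc ∑ i, ‖e i‖ ^ 2 ≤ ∑ _i : Fin n, c ^ 2 :=
        Finset.sum_le_sum fun i _ => by
          rw [Real.norm_eq_abs]
          exact pow_le_pow_left₀ (abs_nonneg _) (he i) 2
    _ = n * c ^ 2 := by simp

/-- A point of a convex set containing a ball of radius `r`, perturbed by `e`, is brought back into
the set by shrinking towards the center. -/
theorem smul_add_mem_of_convex {E : Type*} [NormedAddCommGroup E] [NormedSpace ℝ E] {G : Set E}
    (hG : Convex ℝ G) {r D : ℝ} (hr : 0 < r) (hball : Metric.closedBall 0 r ⊆ G) (hD : 0 ≤ D)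
    {p e : E} (hp : p ∈ G) (he : ‖e‖ ≤ r * D) : (1 + D)⁻¹ • (p + e) ∈ G := by
  have hD1 : 1 + D ≠ 0 := by positivity
  -- The target is the convex combination of `p` and `D⁻¹ • e` with weights `1/(1+D)` and `D/(1+D)`.
  -- For `D = 0` the convention `0⁻¹ = 0` makes this point the center, and `he` forces `e = 0`.
  have hmem : D⁻¹ • e ∈ G := by
    refine hball (mem_closedBall_zero_iff.2 ?_)
    rw [norm_smul, norm_inv, Real.norm_of_nonneg hD]
    rcases hD.eq_or_lt with h | h
    · simp [← h, hr.le]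
    · rw [inv_mul_le_iff₀ h]
      linarith
  have heq : e = D • D⁻¹ • e := by
    rcases hD.eq_or_lt with h | h
    · have : e = 0 := by
        rw [← norm_le_zero_iff]
        simpa [← h] using he
      simp [this]
    · rw [smul_smul, mul_inv_cancel₀ h.ne', one_smul]
  have hconv := hG hp hmem (a := (1 + D)⁻¹) (b := (1 + D)⁻¹ * D) (by positivity) (by positivity)
    (by field_simp)
  rwa [mul_smul, ← heq, ← smul_add] at hconv

theorem inv_one_add_smul_mem {X : Set (EuclideanSpace ℝ (Fin d))} (hX : StarConvex ℝ 0 X)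
    {u : EuclideanSpace ℝ (Fin d)} (hu : u ∈ X) {D : ℝ} (hD : 0 ≤ D) : (1 + D)⁻¹ • u ∈ X :=
  hX.smul_mem hu (by positivity) (inv_le_one_of_one_le₀ (by linarith))

/-- Error plus margin raise the constraint value at `x_*` to at most `b + 2β_t‖x_*‖ = b(1 + D)`, and
both terms of the pessimistic constraint scale linearly. -/
theorem scaled_mem_linPessimisticSet {X : Set (EuclideanSpace ℝ (Fin d))}
    (hX : StarConvex ℝ 0 X) {a xstar : EuclideanSpace ℝ (Fin d)} {b : ℝ} (hb : 0 < b)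
    (hxstar : xstar ∈ linFeasibleSet X a b) {β : ℕ → ℝ} {z : ℕ → ℝ} {t : ℕ} (hβ : 0 ≤ β t)
    (hconf : ∀ u, |inner ℝ (ridgeEstimator lam x z t) u - inner ℝ a u| ≤
      β t * width lam x t u) :
    (1 + 2 * (1 / b) * (β t * width lam x t xstar))⁻¹ • xstar ∈
      linPessimisticSet X b lam β x z t := by
  have hw := width_nonneg (lam := lam) x t xstar
  set D := 2 * (1 / b) * (β t * width lam x t xstar) with hD
  have hD0 : 0 ≤ D := by positivity
  refine ⟨inv_one_add_smul_mem hX hxstar.1 hD0, ?_⟩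
  rw [inner_smul_right, width_smul x t (by positivity)]
  have h1 := (abs_le.1 (hconf xstar)).2
  have h2 := hxstar.2
  have h3 : b * D = 2 * (β t * width lam x t xstar) := by
    rw [hD]
    field_simp
  calc _ = (1 + D)⁻¹ * (inner ℝ (ridgeEstimator lam x z t) xstar
        + β t * width lam x t xstar) := by ring
    _ ≤ (1 + D)⁻¹ * (b * (1 + D)) := by
        gcongr
        linarith
    _ = b := by field_simp

/-- Each constraint coordinate is a scalar regression with a row of `A` as parameter, so the scalar
error bound applies row by row. -/
theorem applyMat_ridgeMatrix_apply {n : ℕ} (A : Matrix (Fin n) (Fin d) ℝ)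
    (η : ℕ → EuclideanSpace ℝ (Fin n)) (t : ℕ) (u : EuclideanSpace ℝ (Fin d)) (i : Fin n) :
    applyMat (ridgeMatrix lam x (vectorObs A x η) t) u i =
      inner ℝ (ridgeEstimator lam x
        (scalarObs (WithLp.toLp 2 (A i)) x fun k => η k i) t) u := by
  have : (fun k => vectorObs A x η k i) = scalarObs (WithLp.toLp 2 (A i)) x fun k => η k i := by
    ext k
    simp [vectorObs, scalarObs, applyMat, Matrix.mulVec, inner_eq_dotProduct, dotProduct_comm]
  rw [inner_eq_dotProduct, dotProduct_comm, ← this]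
  rfl

/-- Error and margin form a vector `e` with coordinates at most `2β_t‖x_*‖`. Passing from sup norm
to Euclidean norm costs `√n`, so `‖e‖ ≤ rD`, and convexity of `G` brings the shrunk point back. -/
theorem scaled_mem_pessimisticSet {n : ℕ} {X : Set (EuclideanSpace ℝ (Fin d))}
    (hX : StarConvex ℝ 0 X) {A : Matrix (Fin n) (Fin d) ℝ} {G : Set (EuclideanSpace ℝ (Fin n))}
    (hG : Convex ℝ G) {r : ℝ} (hr : 0 < r) (hball : Metric.closedBall 0 r ⊆ G)
    {xstar : EuclideanSpace ℝ (Fin d)} (hxstar : xstar ∈ feasibleSet X A G)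
    {β : ℕ → ℝ} {η : ℕ → EuclideanSpace ℝ (Fin n)} {t : ℕ} (hβ : 0 ≤ β t)
    (hconf : ∀ i, ∀ u, |inner ℝ (ridgeEstimator lam x
      (scalarObs (WithLp.toLp 2 (A i)) x fun k => η k i) t) u
        - inner ℝ (WithLp.toLp 2 (A i) : EuclideanSpace ℝ (Fin d)) u| ≤ β t * width lam x t u) :
    (1 + 2 * (√n / r) * (β t * width lam x t xstar))⁻¹ • xstar ∈
      pessimisticSet X G lam β x (vectorObs A x η) t := by
  have hw := width_nonneg (lam := lam) x t xstar
  set D := 2 * (√n / r) * (β t * width lam x t xstar) with hD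
  have hD0 : 0 ≤ D := by positivity
  refine ⟨inv_one_add_smul_mem hX hxstar.1 hD0, fun v hv => ?_⟩
  set Ahat := ridgeMatrix lam x (vectorObs A x η) t with hAhat
  let e : EuclideanSpace ℝ (Fin n) := applyMat Ahat xstar - applyMat A xstar
    + (β t * width lam x t xstar) • v
  have he : ∀ i, |e i| ≤ 2 * (β t * width lam x t xstar) := by
    intro i
    have h1 := hconf i xstar
    rw [← applyMat_ridgeMatrix_apply] at h1
    have h2 : inner ℝ (WithLp.toLp 2 (A i) : EuclideanSpace ℝ (Fin d)) xstar =
        applyMat A xstar i := by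
      simp [inner_eq_dotProduct, applyMat, Matrix.mulVec, dotProduct_comm]
    rw [h2] at h1
    have h3 : |β t * width lam x t xstar * v i| ≤ β t * width lam x t xstar := by
      rw [abs_mul, abs_of_nonneg (by positivity)]
      exact mul_le_of_le_one_right (by positivity) (hv i)
    calc |e i| = |(applyMat Ahat xstar i - applyMat A xstar i)
          + β t * width lam x t xstar * v i| := by simp [e]
      _ ≤ _ := (abs_add_le _ _).trans (by linarith)
  have hnorm : ‖e‖ ≤ r * D := by
    refine (norm_le_sqrt_mul_of_abs_le (by positivity) he).trans_eq ?_
    rw [hD]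
    field_simp
  have hmem := smul_add_mem_of_convex hG hr hball hD0 hxstar.2 hnorm
  have heq : applyMat Ahat ((1 + D)⁻¹ • xstar)
      + (β t * width lam x t ((1 + D)⁻¹ • xstar)) • v = (1 + D)⁻¹ • (applyMat A xstar + e) := by
    have h1 : applyMat Ahat ((1 + D)⁻¹ • xstar) = (1 + D)⁻¹ • applyMat Ahat xstar := by
      simp [applyMat, Matrix.mulVec_smul]
    rw [h1, width_smul x t (by positivity)]
    simp only [e]
    module
  rwa [heq]

end Deterministic

/-! ### The union bound and the two regret bounds. -/

theorem one_sub_le_measureReal_of_compl_subset {Ω : Type*} [MeasurableSpace Ω] {μ : Measure Ω}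
    [IsProbabilityMeasure μ] {B E : Set Ω} {δ : ℝ} (hδ : 0 ≤ δ) (hB : μ B ≤ ENNReal.ofReal δ)
    (hE : Bᶜ ⊆ E) : 1 - δ ≤ μ.real E := by
  have h1 : μ.real B ≤ δ := ENNReal.toReal_le_of_le_ofReal hδ hB
  have h2 : μ.real Set.univ ≤ μ.real B + μ.real E := by
    refine (measureReal_mono (μ := μ) (s₂ := B ∪ E) fun ω _ => ?_).trans (measureReal_union_le B E)
    by_cases h : ω ∈ B
    · exact Or.inl h
    · exact Or.inr (hE h)
  rw [probReal_univ] at h2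
  linarith

/-- The regret bound of OPLB for any pessimistic sets that contain the suitably scaled optimal
action whenever the constraint noises are small. -/
theorem oplb_regret_bound {Ω : Type*} [MeasurableSpace Ω] {μ : Measure Ω} [IsProbabilityMeasure μ]
    {d T n : ℕ} (hd : 2 ≤ d) {θ xstar : EuclideanSpace ℝ (Fin d)} {Sθ S q κ ρ lam δ : ℝ}
    (hSθ : 0 < Sθ) (hθ : ‖θ‖ ≤ Sθ) (hS : Sθ ≤ S) (hxstar : ‖xstar‖ ≤ 1) (hq : 0 ≤ q)
    (hκ : κ = 1 + 2 * q * Sθ) (hρ : 0 ≤ ρ) (hlam : 1 ≤ lam) (hδ₀ : 0 < δ) (hδ₁ : δ < 1)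
    {x : ℕ → Ω → EuclideanSpace ℝ (Fin d)} (hx : ∀ t, Measurable (x t))
    {ε : ℕ → Ω → ℝ} (hε : ∀ t, Measurable (ε t)) (hεnoise : IsSubgaussianNoise μ T x ρ ε)
    {η : Fin n → ℕ → Ω → ℝ} (hη : ∀ i t, Measurable (η i t))
    (hηnoise : ∀ i, IsSubgaussianNoise μ T x ρ (η i))
    {P : Ω → ℕ → Set (EuclideanSpace ℝ (Fin d))} (hPb : ∀ ω t, ∀ u ∈ P ω t, ‖u‖ ≤ 1)
    {β : ℕ → ℝ} (hβ : β = confRadius d n ρ lam δ S)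
    (hP : ∀ ω, ∀ t ∈ Finset.Icc 1 T,
      (∀ i, width lam (fun k => x k ω) t (noiseSum (fun k => x k ω) (fun k => η i k ω) t) ≤
        ρ * confLog d lam (δ / ((n : ℝ) + 1)) t) →
      (1 + 2 * q * (β t * width lam (fun k => x k ω) t xstar))⁻¹ • xstar ∈ P ω t)
    (hplay : ∀ ω, PlaysOPLB T (P ω) lam κ β (fun k => x k ω)
      (scalarObs θ (fun k => x k ω) (fun k => ε k ω))) :
    1 - δ ≤ μ.real {ω | regret T θ xstar (fun k => x k ω) ≤
      (1 + κ) * β T * √(2 * d * T * Real.log (1 + T / (lam * d)))} := by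
  have hl0 : 0 < lam := zero_lt_one.trans_le hlam
  have hn0 : (0 : ℝ) < (n : ℝ) + 1 := by positivity
  have hδn : 0 < δ / ((n : ℝ) + 1) := by positivity
  have hδn1 : δ / ((n : ℝ) + 1) ≤ 1 := by
    rw [div_le_one hn0]
    have : (0 : ℝ) ≤ n := n.cast_nonneg
    linarith
  -- Played actions lie in the pessimistic sets, which supplies the norm bound for both
  -- concentration and potential.
  have hxb : ∀ ω, ∀ t ∈ Finset.Icc 1 T, ‖x t ω‖ ≤ 1 := fun ω t ht => hPb ω t _ (hplay ω t ht).1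
  have hS0 : 0 ≤ S := hSθ.le.trans hS
  have hβ0 : ∀ t, 0 ≤ β t := fun t => hβ ▸ confRadius_nonneg hρ hS0 t
  let B : (ℕ → Ω → ℝ) → Set Ω := fun ξ =>
    {ω | ∃ t ∈ Finset.Icc 1 T, ρ * confLog d lam (δ / ((n : ℝ) + 1)) t <
      width lam (fun k => x k ω) t (noiseSum (fun k => x k ω) (fun k => ξ k ω) t)}
  -- One reward process and `n` constraint processes, each at level `δ/(n+1)`.
  have hB : μ (B ε ∪ ⋃ i, B (η i)) ≤ ENNReal.ofReal δ := by
    calc μ (B ε ∪ ⋃ i, B (η i)) ≤ μ (B ε) + ∑ i, μ (B (η i)) :=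
          (measure_union_le _ _).trans (by gcongr; exact measure_iUnion_fintype_le _ _)
      _ ≤ ENNReal.ofReal (δ / ((n : ℝ) + 1)) +
          ∑ _i : Fin n, ENNReal.ofReal (δ / ((n : ℝ) + 1)) := by
          gcongr with i
          · exact measure_exists_width_noiseSum_gt_le hd hl0 hx hε hxb hρ hεnoise hδn hδn1
          · exact measure_exists_width_noiseSum_gt_le hd hl0 hx (hη i) hxb hρ (hηnoise i) hδn hδn1
      _ = ENNReal.ofReal δ := by
          rw [← ENNReal.ofReal_sum_of_nonneg fun _ _ => hδn.le,
            ← ENNReal.ofReal_add hδn.le (Finset.sum_nonneg fun _ _ => hδn.le)]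
          congr 1
          simp only [Finset.sum_const, Finset.card_univ, Fintype.card_fin, nsmul_eq_mul]
          field_simp
          ring
  refine one_sub_le_measureReal_of_compl_subset hδ₀.le hB fun ω hω => ?_
  have hgood : ∀ ξ, ω ∉ B ξ → ∀ t ∈ Finset.Icc 1 T,
      width lam (fun k => x k ω) t (noiseSum (fun k => x k ω) (fun k => ξ k ω) t) ≤
        ρ * confLog d lam (δ / ((n : ℝ) + 1)) t := by
    intro ξ hξ t ht
    by_contra! hcon
    exact hξ ⟨t, ht, hcon⟩
  have hωε : ω ∉ B ε := fun h => hω (Or.inl h)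
  have hωη : ∀ i, ω ∉ B (η i) := fun i h => hω (Or.inr (Set.mem_iUnion.2 ⟨i, h⟩))
  refine regret_le_of_round_le (fun k => x k ω) hlam (by omega) (by rw [hκ]; positivity)
    (fun t ht => ?_) (hβ0 T) (hxb ω) fun t ht => ?_
  · rw [hβ]
    exact confRadius_mono hρ hl0 hδ₀ (Finset.mem_Icc.1 ht).1 (Finset.mem_Icc.1 ht).2
  · refine inner_sub_le_of_isMaxOn (fun k => x k ω) (hβ0 t) hq hκ ?_ (fun u => ?_)
      (hP ω t ht fun i => hgood _ (hωη i) t ht) (hplay ω t ht).2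
    · calc inner ℝ θ xstar ≤ ‖θ‖ * ‖xstar‖ := real_inner_le_norm _ _
        _ ≤ Sθ * 1 := by gcongr
        _ = Sθ := mul_one _
    · rw [hβ, confRadius_eq]
      exact abs_inner_ridgeEstimator_sub_le _ hl0 (hgood ε hωε t ht) (hθ.trans hS) u

end SafeLinearBandit

theorem mainTheorem8 {Ω : Type*} [MeasurableSpace Ω] (μ : Measure Ω) [IsProbabilityMeasure μ]
    (d T : ℕ) (hd : 2 ≤ d)
    -- the action set
    (X : Set (EuclideanSpace ℝ (Fin d))) (hXclosed : IsClosed X) (hXstar : StarConvex ℝ 0 X)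
    (hXbdd : ∀ u ∈ X, ‖u‖ ≤ 1)
    -- the reward vector and the optimal action
    (θ xstar : EuclideanSpace ℝ (Fin d)) (Sθ : ℝ) (hSθ : 0 < Sθ) (hθ : ‖θ‖ ≤ Sθ)
    (hpos : 0 < inner ℝ θ xstar)
    -- the parameters
    (ρ lam δ : ℝ) (hρ : 0 ≤ ρ) (hlam : 1 ≤ lam) (hδ₀ : 0 < δ) (hδ₁ : δ < 1)
    -- the actions and the reward noise
    (x : ℕ → Ω → EuclideanSpace ℝ (Fin d)) (hx : ∀ t, Measurable (x t))
    (ε : ℕ → Ω → ℝ) (hε : ∀ t, Measurable (ε t))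
    (hεnoise : SafeLinearBandit.IsSubgaussianNoise μ T x ρ ε) :
    -- linked convex constraints
    (∀ (n : ℕ) (_ : 1 ≤ n) (A : Matrix (Fin n) (Fin d) ℝ) (G : Set (EuclideanSpace ℝ (Fin n)))
      (SA r κ : ℝ) (β : ℕ → ℝ) (η : ℕ → Ω → EuclideanSpace ℝ (Fin n)),
      0 < SA → (∀ i, ‖(WithLp.toLp 2 (A i) : EuclideanSpace ℝ (Fin d))‖ ≤ SA) →
      Convex ℝ G → 0 < r → Metric.closedBall 0 r ⊆ G → r / (Real.sqrt n * SA) ≤ 1 →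
      (xstar ∈ SafeLinearBandit.feasibleSet X A G ∧
        IsMaxOn (fun u => inner ℝ θ u) (SafeLinearBandit.feasibleSet X A G) xstar) →
      (∀ t, Measurable (η t)) →
      (∀ i, SafeLinearBandit.IsSubgaussianNoise μ T x ρ (fun t ω => η t ω i)) →
      β = SafeLinearBandit.confRadius d n ρ lam δ (max SA Sθ) →
      κ = 1 + 2 * Real.sqrt n * Sθ / r →
      (∀ ω, SafeLinearBandit.PlaysOPLB T
        (SafeLinearBandit.pessimisticSet X G lam β (fun k => x k ω)
          (SafeLinearBandit.vectorObs A (fun k => x k ω) (fun k => η k ω)))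
        lam κ β (fun k => x k ω)
        (SafeLinearBandit.scalarObs θ (fun k => x k ω) (fun k => ε k ω))) →
      1 - δ ≤ μ.real {ω | SafeLinearBandit.regret T θ xstar (fun k => x k ω) ≤
        2 * (1 + Real.sqrt n * Sθ / r) * β T *
          Real.sqrt (2 * d * T * Real.log (1 + T / (lam * d)))}) ∧
    -- a single linear constraint
    (∀ (a : EuclideanSpace ℝ (Fin d)) (b Sa κ : ℝ) (β : ℕ → ℝ) (η : ℕ → Ω → ℝ),
      0 < Sa → ‖a‖ ≤ Sa → 0 < b → b / Sa ≤ 1 →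
      (xstar ∈ SafeLinearBandit.linFeasibleSet X a b ∧
        IsMaxOn (fun u => inner ℝ θ u) (SafeLinearBandit.linFeasibleSet X a b) xstar) →
      (∀ t, Measurable (η t)) →
      SafeLinearBandit.IsSubgaussianNoise μ T x ρ η →
      β = SafeLinearBandit.confRadius d 1 ρ lam δ (max Sa Sθ) →
      κ = 1 + 2 * Sθ / b →
      (∀ ω, SafeLinearBandit.PlaysOPLB T
        (SafeLinearBandit.linPessimisticSet X b lam β (fun k => x k ω)
          (SafeLinearBandit.scalarObs a (fun k => x k ω) (fun k => η k ω)))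
        lam κ β (fun k => x k ω)
        (SafeLinearBandit.scalarObs θ (fun k => x k ω) (fun k => ε k ω))) →
      1 - δ ≤ μ.real {ω | SafeLinearBandit.regret T θ xstar (fun k => x k ω) ≤
        (1 + κ) * β T * Real.sqrt (2 * d * T * Real.log (1 + T / (lam * d)))}) := by
  constructor
  · intro n hn A G SA r κ β η hSA hA hG hr hball _ hopt hη hηnoise hβ hκ hplay
    have hβ0 : ∀ t, 0 ≤ β t := fun t => hβ ▸ SafeLinearBandit.confRadius_nonneg hρ
      (hSθ.le.trans (le_max_right _ _)) t
    have h := SafeLinearBandit.oplb_regret_bound (κ := κ) (q := √n / r)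
      (η := fun i t ω => η t ω i) hd hSθ hθ (le_max_right SA Sθ)
      (hXbdd _ hopt.1.1) (by positivity) (by rw [hκ]; ring) hρ hlam hδ₀ hδ₁ hx hε hεnoise
      (fun i t => by have := hη t; fun_prop) hηnoise (fun ω t u hu => hXbdd u hu.1) hβ
      (fun ω t ht hsmall => SafeLinearBandit.scaled_mem_pessimisticSet (fun k => x k ω) hXstar hG
        hr hball hopt.1 (hβ0 t) fun i u => by
          rw [hβ, SafeLinearBandit.confRadius_eq]
          exact SafeLinearBandit.abs_inner_ridgeEstimator_sub_le _ (zero_lt_one.trans_le hlam)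
            (hsmall i) ((hA i).trans (le_max_left _ _)) u) hplay
    -- The leading 2 of the stated bound is the 1 in `κ` plus the 1 from the upper confidence bound
    -- at the played action.
    have h2 : 1 + κ = 2 * (1 + √n * Sθ / r) := by rw [hκ]; ring
    rwa [h2] at h
  · intro a b Sa κ β η hSa ha hb _ hopt hη hηnoise hβ hκ hplay
    have hβ0 : ∀ t, 0 ≤ β t := fun t => hβ ▸ SafeLinearBandit.confRadius_nonneg hρ
      (hSθ.le.trans (le_max_right _ _)) t
    exact SafeLinearBandit.oplb_regret_bound (κ := κ) (q := 1 / b) (n := 1)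
      (η := fun _ => η) hd hSθ hθ (le_max_right Sa Sθ)
      (hXbdd _ hopt.1.1) (by positivity) (by rw [hκ]; ring) hρ hlam hδ₀ hδ₁ hx hε hεnoise
      (fun _ => hη) (fun _ => hηnoise) (fun ω t u hu => hXbdd u hu.1) hβ
      (fun ω t ht hsmall => SafeLinearBandit.scaled_mem_linPessimisticSet (fun k => x k ω) hXstar
        hb hopt.1 (hβ0 t) fun u => by
          rw [hβ, SafeLinearBandit.confRadius_eq]
          exact SafeLinearBandit.abs_inner_ridgeEstimator_sub_le _ (zero_lt_one.trans_le hlam)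
            (hsmall 0) (ha.trans (le_max_left _ _)) u) hplay
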